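/- \textbf{Theorem (Frobenius reduction and invariant coordinates).} Let $\mathcal S$ be a smooth $d$-dimensional manifold (for instance an open subset of $\mathbb R^d$), let $\Omega\subseteq\mathcal S$ be open, and let $X_1,\dots,X_K$ be vector fields on $\mathcal S$ that are smooth ($C^\infty$) on $\Omega$. Put $\mathcal D(s)=\mathrm{span}\{X_1(s),\dots,X_K(s)\}\subseteq T_s\mathcal S$. Assume that $\mathcal D$ has constant rank $K$ on $\Omega$, i.e. $\dim\mathcal D(s)=K$ for all $s\in\Omega$, and that it is involutive on $\Omega$, i.e. $[X_i,X_j](s)\in\mathcal D(s)$ for all $i,j$ and all $s\in\Omega$. For an open set $U\subseteq\Omega$, a \emph{connected integral manifold} of $\mathcal D$ in $U$ is the image in $U$ of an injective smooth immersion $f:N\to\mathcal S$ of a connected smooth $K$-dimensional manifold $N$ with $df_x(T_xN)=\mathcal D(f(x))$ for all $x\in N$; an \emph{integral leaf} of $\mathcal D$ in $U$ is a maximal connected integral manifold of $\mathcal D$ in $U$. The \emph{local orbit space} $U/{\sim}$ is the topological quotient of $U$ by the equivalence relation in which $p\sim q$ if $q$ is reached from $p$ by finitely many steps, each along an integral curve,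 in either direction of time, of one of the fields $X_1,\dots,X_K$ that stays inside $U$. Then every $s_0\in\Omega$ has an open neighbourhood $U\subseteq\Omega$ with smooth functions $I_1,\dots,I_{d-K}:U\to\mathbb R$ such that, with $I=(I_1,\dots,I_{d-K}):U\to\mathbb R^{d-K}$: (a) (invariants) $X_k(s)\cdot\nabla I_\alpha(s)=dI_\alpha(s)(X_k(s))=0$ for all $s\in U$, $1\le k\le K$, $1\le\alpha\le d-K$; (b) (functional independence) the differentials $dI_1(s),\dots,dI_{d-K}(s)$ are linearly independent at every $s\in U$; (c) $I$ is constant on every integral leaf of $\mathcal D$ in $U$; moreover the integral leaves of $\mathcal D$ in $U$ are exactly the nonempty level sets of $I$ in $U$; (d) (intrinsic coordinates) $I$ descends to the local orbit space: there is a map $J:U/{\sim}\to\mathbb R^{d-K}$ with $J([s])=I(s)$ for all $s\in U$, and $J$ is a homeomorphism of $U/{\sim}$ onto an open subset of $\mathbb R^{d-K}$. So $z=I(s)$ is a coordinate system on $U/{\sim}$. -/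

import Mathlib

open scoped Manifold ContDiff

/-- The distribution `D(s) = span {X₁(s), …, X_K(s)} ⊆ T_s M` spanned by vector fields. -/
noncomputable def distributionSpan {d K : ℕ} {M : Type*} [TopologicalSpace M]
    [ChartedSpace (EuclideanSpace ℝ (Fin d)) M]
    (X : Fin K → (s : M) → TangentSpace (𝓡 d) s) (s : M) :
    Submodule ℝ (TangentSpace (𝓡 d) s) :=
  Submodule.span ℝ (Set.range fun k => X k s)

/-- `L` is a connected (immersed) integral manifold, of dimension `K` and contained in `U`, of the
distribution `D`: it is the image of an injective smooth immersion `f` of a connected smooth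
`K`-manifold `N` whose tangent spaces are the spaces of `D`.  (A second countable Hausdorff
manifold has at most continuum many points, so manifolds `N` in `Type` suffice.) -/
def IsConnectedIntegralManifold {d : ℕ} {M : Type*} [TopologicalSpace M]
    [ChartedSpace (EuclideanSpace ℝ (Fin d)) M] (K : ℕ)
    (D : (s : M) → Submodule ℝ (TangentSpace (𝓡 d) s)) (U L : Set M) : Prop :=
  ∃ (N : Type) (_ : TopologicalSpace N) (_ : ChartedSpace (EuclideanSpace ℝ (Fin K)) N)
    (_ : IsManifold (𝓡 K) ∞ N) (_ : T2Space N) (_ : SecondCountableTopology N)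
    (_ : ConnectedSpace N) (f : N → M),
    ContMDiff (𝓡 K) (𝓡 d) ∞ f ∧
    Function.Injective f ∧
    (∀ x : N, Function.Injective (mfderiv (𝓡 K) (𝓡 d) f x)) ∧
    (∀ x : N, LinearMap.range (mfderiv (𝓡 K) (𝓡 d) f x).toLinearMap = D (f x)) ∧
    Set.range f = L ∧ L ⊆ U

/-- The integral leaves of `D` in `U`: the maximal connected integral manifolds of `D` that are
contained in `U`. -/
def IsIntegralLeaf {d : ℕ} {M : Type*} [TopologicalSpace M]
    [ChartedSpace (EuclideanSpace ℝ (Fin d)) M] (K : ℕ)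
    (D : (s : M) → Submodule ℝ (TangentSpace (𝓡 d) s)) (U L : Set M) : Prop :=
  Maximal (IsConnectedIntegralManifold K D U) L

/-- `p` is moved to `q` inside `U` by the flow of one of the vector fields `X k`. -/
def FlowStep {d K : ℕ} {M : Type*} [TopologicalSpace M]
    [ChartedSpace (EuclideanSpace ℝ (Fin d)) M]
    (X : Fin K → (s : M) → TangentSpace (𝓡 d) s) (U : Set M) (p q : U) : Prop :=
  ∃ (k : Fin K) (γ : ℝ → M) (a b : ℝ), γ a = p ∧ γ b = q ∧
    (∀ t ∈ Set.uIcc a b, γ t ∈ U) ∧ IsMIntegralCurveOn γ (X k) (Set.uIcc a b)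

/-- Two points of `U` lie on the same local orbit if finitely many flow steps inside `U` lead from
one to the other. -/
def localOrbitSetoid {d K : ℕ} {M : Type*} [TopologicalSpace M]
    [ChartedSpace (EuclideanSpace ℝ (Fin d)) M]
    (X : Fin K → (s : M) → TangentSpace (𝓡 d) s) (U : Set M) : Setoid U :=
  Relation.EqvGen.setoid (FlowStep X U)

/-- The local orbit space `U / ∼`; as a `Quotient`, it carries the quotient topology. -/
abbrev LocalOrbitSpace {d K : ℕ} {M : Type*} [TopologicalSpace M]
    [ChartedSpace (EuclideanSpace ℝ (Fin d)) M]
    (X : Fin K → (s : M) → TangentSpace (𝓡 d) s) (U : Set M) : Type _ :=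
  Quotient (localOrbitSetoid X U)

/-- The differential `df(s) : T_s M → ℝ` of a scalar function; `df(s)(X(s)) = X(s) · ∇f(s)`. -/
noncomputable def scalarDifferential {d : ℕ} {M : Type*} [TopologicalSpace M]
    [ChartedSpace (EuclideanSpace ℝ (Fin d)) M] (f : M → ℝ) (s : M) :
    TangentSpace (𝓡 d) s →L[ℝ] ℝ :=
  mfderiv (𝓡 d) 𝓘(ℝ, ℝ) f s

/-! The neighbourhood `U` is the domain of a flat chart of the distribution `D`: coordinates `κ`
with values in a product of two balls, in which `D` is the kernel of the differential of the second
coordinate. The functions `I` are the components of this second coordinate; their invariance and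
their independence are immediate from the flatness of the chart.

*Existence of flat charts.* In a chart of the manifold, let `π` be a linear projection that is an
isomorphism on `D` at the base point. Near that point `D` has a unique frame `A` that `π` maps to a
given constant frame. The brackets of this frame lie in `D` by involutivity and in the kernel of `π`
since `π ∘ A` is constant, so they vanish (`commute_of_involutive`). For a commuting frame the total
differential equation `∂Ψ/∂c = A(Ψ)`, `Ψ(0, x) = x`, has a solution `Ψ` smooth in `(c, x)`
(`exists_smooth_multiflow`): `Ψ(c, x)` is the value at time `1` of the solution of `a' = A(a) c`,
`a(0) = x`. Its smoothness comes from the implicit function theorem in the Banach space of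
continuous curves, where `A` acts by a smooth superposition operator, and commutation is what
identifies the derivative in `c`, by Grönwall's inequality for the variational equation. Moving an
affine transversal by `Ψ` gives the inverse of a flat chart (`exists_straightening`,
`exists_isFlatChart`).

*Leaves.* The second coordinate has vanishing derivative along a connected integral manifold, so
such a manifold lies in a plaque, a slice on which that coordinate is constant. Conversely each
plaque is a connected integral manifold, parametrized by a ball. So the plaques are the leaves
(`IsFlatChart.isIntegralLeaf_iff`).

*Orbits.* In the same way an integral curve of one of the fields stays in a plaque. On a plaque the
fields span the tangent spaces, so by the inverse function theorem, applied to the composition of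
the local flows of all fields, the orbits in a plaque are open; as a plaque is connected, it is a
single orbit (`IsFlowInvariant.mem_iff`, `IsFlatChart.localOrbitSetoid_iff`). The second coordinate
thus descends to an injective continuous open map on the orbit space.
-/

namespace Frobenius

open Set Filter Topology

universe u

/-! ### Superposition operators -/

section Superposition

variable {X : Type*} [TopologicalSpace X] [CompactSpace X]
  {E F : Type u} [NormedAddCommGroup E] [NormedSpace ℝ E] [NormedAddCommGroup F] [NormedSpace ℝ F]
  {P Q R : Type*} [NormedAddCommGroup P] [NormedSpace ℝ P] [NormedAddCommGroup Q]
  [NormedSpace ℝ Q] [NormedAddCommGroup R] [NormedSpace ℝ R]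

/-- The pointwise application of a bounded bilinear map to continuous functions on a compact
space, as a bounded bilinear map. -/
noncomputable def pointwiseBilinear (X : Type*) [TopologicalSpace X] [CompactSpace X]
    (B : P →L[ℝ] Q →L[ℝ] R) : C(X, P) →L[ℝ] C(X, Q) →L[ℝ] C(X, R) :=
  LinearMap.mkContinuous₂
    (LinearMap.mk₂ ℝ (fun f g => ⟨fun t => B (f t) (g t), by fun_prop⟩)
      (fun _ _ _ => by ext; simp) (fun _ _ _ => by ext; simp)
      (fun _ _ _ => by ext; simp) (fun _ _ _ => by ext; simp)) ‖B‖ (fun f g => by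
        rw [ContinuousMap.norm_le _ (by positivity)]
        intro t
        refine (B.le_opNorm₂ _ _).trans ?_
        gcongr
        · exact f.norm_coe_le_norm t
        · exact g.norm_coe_le_norm t)

/-- The superposition operator `a ↦ A ∘ a` on continuous functions is differentiable, with
derivative the multiplication by `A' ∘ a`. -/
lemma hasFDerivAt_superposition {A : C(E, F)} {A' : C(E, E →L[ℝ] F)}
    (hA : ∀ x, HasFDerivAt A (A' x) x) (a : C(X, E)) :
    HasFDerivAt (fun b : C(X, E) => A.comp b)
      (pointwiseBilinear X (ContinuousLinearMap.id ℝ (E →L[ℝ] F)) (A'.comp a)) a := by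
  rw [hasFDerivAt_iff_isLittleO_nhds_zero, Asymptotics.isLittleO_iff]
  intro ε hε
  have hcont : Continuous fun b : C(X, E) => A'.comp b := by fun_prop
  obtain ⟨δ, hδ, H⟩ := Metric.continuous_iff (f := fun b : C(X, E) => A'.comp b) |>.1 hcont a ε hε
  filter_upwards [Metric.ball_mem_nhds (0 : C(X, E)) hδ] with h hh
  rw [ContinuousMap.norm_le _ (by positivity)]
  intro t
  -- Compare `a` with its translates by constants, to get a modulus of continuity uniform in `t`.
  have key : ∀ z ∈ Metric.ball (a t) δ, ‖A' z - A' (a t)‖ ≤ ε := by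
    intro z hz
    have h1 : dist (a + ContinuousMap.const X (z - a t)) a < δ := by
      rw [dist_eq_norm, add_sub_cancel_left]
      refine lt_of_le_of_lt ?_ (mem_ball_iff_norm.1 hz)
      rw [ContinuousMap.norm_le _ (norm_nonneg _)]
      exact fun s => le_rfl
    have h2 := (ContinuousMap.dist_apply_le_dist t).trans (H _ h1).le
    simpa [dist_eq_norm] using h2
  have hht : ‖h t‖ ≤ ‖h‖ := h.norm_coe_le_norm t
  have h3 := (convex_ball (a t) δ).norm_image_sub_le_of_norm_hasFDerivWithin_le'
    (fun x _ => (hA x).hasFDerivWithinAt) key (Metric.mem_ball_self hδ)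
    (y := a t + h t) (by
      rw [mem_ball_iff_norm, add_sub_cancel_left]
      exact hht.trans_lt (by simpa using hh))
  rw [add_sub_cancel_left] at h3
  exact h3.trans (by gcongr)

/-- The induction on the order of differentiability replaces the target `F` by `E →L[ℝ] F`, which is
why `E` and `F` share a universe. -/
lemma contDiff_superposition_nat (n : ℕ) : ∀ {F : Type u} [NormedAddCommGroup F]
    [NormedSpace ℝ F] (A : C(E, F)), ContDiff ℝ ∞ A →
      ContDiff ℝ n fun b : C(X, E) => A.comp b := by
  induction n with
  | zero =>
    intro F _ _ A _
    exact contDiff_zero.2 (by fun_prop)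
  | succ n ih =>
    intro F _ _ A hA
    have hA' : ContDiff ℝ ∞ (fderiv ℝ A) := hA.fderiv_right le_rfl
    rw [Nat.cast_succ, contDiff_succ_iff_hasFDerivAt]
    exact ⟨_, (ContinuousLinearMap.contDiff _).comp (ih ⟨fderiv ℝ A, hA'.continuous⟩ hA'),
      hasFDerivAt_superposition (A' := ⟨fderiv ℝ A, hA'.continuous⟩)
        fun x => (hA.differentiable (by simp) x).hasFDerivAt⟩

/-- The superposition operator of a smooth map is smooth. -/
lemma contDiff_superposition (A : C(E, F)) (hA : ContDiff ℝ ∞ A) :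
    ContDiff ℝ ∞ fun b : C(X, E) => A.comp b :=
  contDiff_infty.2 fun n => contDiff_superposition_nat n A hA

end Superposition

/-! ### The smooth inverse function theorem -/

section Inverse

variable {E F : Type*} [NormedAddCommGroup E] [NormedSpace ℝ E] [CompleteSpace E]
  [NormedAddCommGroup F] [NormedSpace ℝ F]

/-- The inverse function theorem for maps smooth on a neighbourhood, with an inverse that is smooth
on its whole domain. -/
lemma exists_smooth_openPartialHomeomorph {f : E → F} {s : Set E} (hs : IsOpen s)
    (hf : ContDiffOn ℝ ∞ f s) {a : E} (ha : a ∈ s) {f' : E ≃L[ℝ] F}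
    (hf' : HasFDerivAt f (f' : E →L[ℝ] F) a) :
    ∃ Φ : OpenPartialHomeomorph E F, ⇑Φ = f ∧ a ∈ Φ.source ∧ Φ.source ⊆ s ∧
      ContDiffOn ℝ ∞ Φ.symm Φ.target := by
  have hfa : ContDiffAt ℝ ∞ f a := hf.contDiffAt (hs.mem_nhds ha)
  let Φ₀ := hfa.toOpenPartialHomeomorph f hf' (by simp)
  have hcont : ContinuousOn (fderiv ℝ f) s := hf.continuousOn_fderiv_of_isOpen hs (by simp)
  let t : Set E := s ∩ fderiv ℝ f ⁻¹' range ((↑) : (E ≃L[ℝ] F) → E →L[ℝ] F)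
  have ht : IsOpen t := hcont.isOpen_inter_preimage hs ContinuousLinearEquiv.isOpen
  have hat : a ∈ t := ⟨ha, f', hf'.fderiv.symm⟩
  -- On the open set `t`, where the derivative is invertible, the inverse is smooth.
  refine ⟨Φ₀.restrOpen t ht, rfl,
    ⟨hfa.mem_toOpenPartialHomeomorph_source hf' (by simp), hat⟩, fun x hx => hx.2.1, ?_⟩
  intro y hy
  have hy' : (Φ₀.restrOpen t ht).symm y ∈ t := ((Φ₀.restrOpen t ht).map_target hy).2
  obtain ⟨g', hg'⟩ := hy'.2
  have hfy := hf.contDiffAt (hs.mem_nhds hy'.1)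
  refine ContDiffAt.contDiffWithinAt ?_
  refine (Φ₀.restrOpen t ht).contDiffAt_symm hy (f₀' := g') ?_ hfy
  rw [hg']
  exact (hfy.differentiableAt (by simp)).hasFDerivAt

end Inverse

/-! ### Flows depending smoothly on all parameters -/

section Flow

open unitInterval

variable {E F : Type u} [NormedAddCommGroup E] [NormedSpace ℝ E]
  [NormedAddCommGroup F] [NormedSpace ℝ F]
  {V : Type*} [NormedAddCommGroup V] [NormedSpace ℝ V]

/-- The inclusion of the constant functions. -/
noncomputable def constCLM (X : Type*) [TopologicalSpace X] [CompactSpace X] (E : Type*)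
    [NormedAddCommGroup E] [NormedSpace ℝ E] : E →L[ℝ] C(X, E) where
  toFun := ContinuousMap.const X
  map_add' _ _ := rfl
  map_smul' _ _ := rfl
  cont := ContinuousMap.continuous_const'

@[simp]
lemma constCLM_apply {X : Type*} [TopologicalSpace X] [CompactSpace X] (x : V) (t : X) :
    constCLM X V x t = x := rfl

/-- A function on the unit interval, extended to the line by its values at the endpoints. -/
noncomputable def extendUnit (f : C(I, E)) (t : ℝ) : E := f (projIcc 0 1 zero_le_one t)

omit [NormedSpace ℝ E] in
lemma continuous_extendUnit (f : C(I, E)) : Continuous (extendUnit f) :=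
  f.continuous.comp continuous_projIcc

omit [NormedSpace ℝ E] in
lemma extendUnit_coe (f : C(I, E)) (t : I) : extendUnit f t = f t := by
  simp [extendUnit]

variable [CompleteSpace E]

/-- The Volterra operator `f ↦ (t ↦ ∫₀ᵗ f)`. -/
noncomputable def volterra (E : Type*) [NormedAddCommGroup E] [NormedSpace ℝ E]
    [CompleteSpace E] : C(I, E) →L[ℝ] C(I, E) :=
  LinearMap.mkContinuous
    { toFun := fun f => ⟨fun t => ∫ s in (0 : ℝ)..t, extendUnit f s, by
        have := intervalIntegral.continuous_primitive (μ := MeasureTheory.volume)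
          (fun a b => (continuous_extendUnit f).intervalIntegrable a b) 0
        exact this.comp continuous_subtype_val⟩
      map_add' := fun f g => by
        ext t
        exact intervalIntegral.integral_add ((continuous_extendUnit f).intervalIntegrable _ _)
          ((continuous_extendUnit g).intervalIntegrable _ _)
      map_smul' := fun c f => by
        ext t
        exact intervalIntegral.integral_smul c (extendUnit f) } 1 (fun f => by
      rw [one_mul, ContinuousMap.norm_le _ (norm_nonneg _)]
      intro t
      have := intervalIntegral.norm_integral_le_of_norm_le_const (a := 0) (b := (t : ℝ))
        (f := extendUnit f) (C := ‖f‖) (fun s _ => f.norm_coe_le_norm _)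
      refine this.trans (mul_le_of_le_one_right (norm_nonneg _) ?_)
      rw [sub_zero, abs_of_nonneg t.2.1]
      exact t.2.2)

lemma volterra_apply (f : C(I, E)) (t : I) :
    volterra E f t = ∫ s in (0 : ℝ)..t, extendUnit f s := rfl

lemma hasDerivAt_integral_extendUnit (f : C(I, E)) (t : ℝ) :
    HasDerivAt (fun t => ∫ s in (0 : ℝ)..t, extendUnit f s) (extendUnit f t) t :=
  (continuous_extendUnit f).integral_hasStrictDerivAt 0 t |>.hasDerivAt

/-- The integrand `t ↦ A(a(t)) c` of the equation `a' = A(a) c`, where `A` takes values in a space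
`F` that acts on the parameters `c` by a bilinear map `B`. -/
noncomputable def velocity (B : F →L[ℝ] V →L[ℝ] E) (A : C(E, F)) (c : V) (a : C(I, E)) : C(I, E) :=
  pointwiseBilinear I B (A.comp a) (constCLM I V c)

omit [CompleteSpace E] in
lemma velocity_apply (B : F →L[ℝ] V →L[ℝ] E) (A : C(E, F)) (c : V) (a : C(I, E)) (t : I) :
    velocity B A c a t = B (A (a t)) c := rfl

/-- The product rule, with the derivative given by its values: this avoids unfolding the derivatives
that occur when the spaces are spaces of curves. -/
lemma exists_hasFDerivAt_bilinear {P Q R S : Type*} [NormedAddCommGroup P] [NormedSpace ℝ P]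
    [NormedAddCommGroup Q] [NormedSpace ℝ Q] [NormedAddCommGroup R] [NormedSpace ℝ R]
    [NormedAddCommGroup S] [NormedSpace ℝ S] (T : P →L[ℝ] Q →L[ℝ] R) {f : S → P} {g : S → Q}
    {f' : S →L[ℝ] P} {g' : S →L[ℝ] Q} {x : S} (hf : HasFDerivAt f f' x)
    (hg : HasFDerivAt g g' x) :
    ∃ D : S →L[ℝ] R, HasFDerivAt (fun x => T (f x) (g x)) D x ∧
      ∀ v, D v = T (f' v) (g x) + T (f x) (g' v) :=
  ⟨_, T.hasFDerivAt_of_bilinear hf hg, fun v => by simp [add_comm]⟩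

omit [CompleteSpace E] in
/-- The variational equation: the derivative of the velocity under a variation of the parameter and
of the curve. -/
lemma hasFDerivAt_velocity (B : F →L[ℝ] V →L[ℝ] E) {A : C(E, F)} (hA : ContDiff ℝ ∞ A)
    {Q : Type*} [NormedAddCommGroup Q] [NormedSpace ℝ Q] {c : Q → V} {a : Q → C(I, E)}
    {c' : Q →L[ℝ] V} {a' : Q →L[ℝ] C(I, E)} {q : Q} (hc : HasFDerivAt c c' q)
    (ha : HasFDerivAt a a' q) :
    ∃ D : Q →L[ℝ] C(I, E), HasFDerivAt (fun q => velocity B A (c q) (a q)) D q ∧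
      ∀ v t, D v t = B (fderiv ℝ A (a q t) (a' v t)) (c q) + B (A (a q t)) (c' v) := by
  let A' : C(E, E →L[ℝ] F) := ⟨fderiv ℝ A, hA.continuous_fderiv (by simp)⟩
  have h0 : HasFDerivAt (fun b : C(I, E) => A.comp b) _ (a q) := hasFDerivAt_superposition
    (A' := A') (fun x => (hA.differentiable (by simp) x).hasFDerivAt) (a q)
  have h1 := HasFDerivAt.comp q h0 ha
  have h2 : HasFDerivAt (fun q => constCLM I V (c q)) ((constCLM I V).comp c') q :=
    (constCLM I V).hasFDerivAt.comp q hc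
  obtain ⟨D, hD, hD'⟩ := exists_hasFDerivAt_bilinear (pointwiseBilinear I B) h1 h2
  refine ⟨D, hD, fun v t => ?_⟩
  rw [hD' v]
  rfl

variable [CompleteSpace V]

/-- Smooth dependence of the solution of `a' = A(a) c`, `a(0) = x` on `(c, x)`, near `c = 0`: this
is the implicit function theorem in the Banach space of curves. -/
theorem exists_smooth_solution (B : F →L[ℝ] V →L[ℝ] E) {A : C(E, F)} (hA : ContDiff ℝ ∞ A)
    (x₀ : E) :
    ∃ (P : Set (V × E)) (a : V × E → C(I, E)), IsOpen P ∧ (0, x₀) ∈ P ∧ ContDiffOn ℝ ∞ a P ∧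
      a (0, x₀) = constCLM I E x₀ ∧
      ∀ p ∈ P, a p = constCLM I E p.2 + volterra E (velocity B A p.1 (a p)) := by
  -- The integral equation for the curve `q.2` with parameters `q.1` is `(G q).2 = 0`.
  let G : (V × E) × C(I, E) → (V × E) × C(I, E) := fun q =>
    (q.1, q.2 - (constCLM I E q.1.2 + volterra E (velocity B A q.1.1 q.2)))
  have hG : ContDiff ℝ ∞ G := by
    have h0 : ContDiff ℝ ∞ fun q : (V × E) × C(I, E) => q.1.1 := contDiff_fst.comp contDiff_fst
    have h1 : ContDiff ℝ ∞ fun q : (V × E) × C(I, E) => velocity B A q.1.1 q.2 := by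
      unfold velocity
      exact ((pointwiseBilinear I B).contDiff.comp
        ((contDiff_superposition A hA).comp contDiff_snd)).clm_apply
        ((constCLM I V).contDiff.comp h0)
    have h2 : ContDiff ℝ ∞ fun q : (V × E) × C(I, E) => q.1.2 := contDiff_snd.comp contDiff_fst
    exact contDiff_fst.prodMk (contDiff_snd.sub (((constCLM I E).contDiff.comp h2).add
      ((volterra E).contDiff.comp h1)))
  let q₀ : (V × E) × C(I, E) := ((0, x₀), constCLM I E x₀)
  have hvel0 : ∀ a : C(I, E), velocity B A 0 a = 0 := fun a => by ext t; simp [velocity_apply]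
  have hG0 : G q₀ = ((0, x₀), 0) := by simp [G, q₀, hvel0]
  obtain ⟨D, hD, hD'⟩ := hasFDerivAt_velocity B hA (q := q₀)
    (c := fun q : (V × E) × C(I, E) => q.1.1) (a := fun q => q.2)
    ((hasFDerivAt_fst (p := q₀.1)).comp q₀ hasFDerivAt_fst) hasFDerivAt_snd
  -- At `c = 0` the derivative does not see the variation of the curve in the integral term.
  let S : V × E →L[ℝ] C(I, E) := -((constCLM I E).comp (ContinuousLinearMap.snd ℝ V E)
    + (volterra E).comp (D.comp (ContinuousLinearMap.inl ℝ (V × E) C(I, E))))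
  let T : ((V × E) × C(I, E)) ≃L[ℝ] (V × E) × C(I, E) :=
    (ContinuousLinearEquiv.refl ℝ (V × E)).skewProd (ContinuousLinearEquiv.refl ℝ C(I, E)) S
  have hT : HasFDerivAt G (T : (V × E) × C(I, E) →L[ℝ] (V × E) × C(I, E)) q₀ := by
    have h := (hasFDerivAt_fst (𝕜 := ℝ) (p := q₀)).prodMk ((hasFDerivAt_snd (𝕜 := ℝ) (p := q₀)).sub
      ((((constCLM I E).hasFDerivAt (x := q₀.1.2)).comp q₀
        ((hasFDerivAt_snd (p := q₀.1)).comp q₀ hasFDerivAt_fst)).add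
        (((volterra E).hasFDerivAt).comp q₀ hD)))
    refine h.congr_fderiv ?_
    have hDinr : ∀ v, D v = D (v.1, 0) := by
      intro v
      ext t
      rw [hD', hD']
      simp [q₀]
    refine ContinuousLinearMap.ext fun v => ?_
    refine Prod.ext (by simp [T]) ?_
    simp only [ContinuousLinearMap.prod_apply, sub_apply,
      add_apply, ContinuousLinearMap.comp_apply, T, S,
      ContinuousLinearEquiv.coe_coe, ContinuousLinearEquiv.skewProd_apply]
    rw [hDinr v]
    simp [sub_eq_add_neg]
  obtain ⟨Φ, hΦ, hmem, -, hsymm⟩ :=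
    exists_smooth_openPartialHomeomorph isOpen_univ hG.contDiffOn (mem_univ q₀) hT
  let j : V × E → (V × E) × C(I, E) := fun p => (p, 0)
  have hj : ContDiff ℝ ∞ j := contDiff_id.prodMk contDiff_const
  have hj0 : j (0, x₀) = Φ q₀ := by rw [hΦ, hG0]
  refine ⟨j ⁻¹' Φ.target, fun p => (Φ.symm (j p)).2, Φ.open_target.preimage hj.continuous, ?_,
    (contDiff_snd.comp_contDiffOn hsymm).comp hj.contDiffOn (fun _ h => h), ?_, ?_⟩
  · rw [mem_preimage, hj0]
    exact Φ.map_source hmem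
  · change (Φ.symm (j (0, x₀))).2 = _
    rw [hj0, Φ.left_inv hmem]
  · intro p hp
    have h := Φ.right_inv hp
    rw [hΦ] at h
    have h1 : (Φ.symm (j p)).1 = p := congrArg Prod.fst h
    have h2 := congrArg Prod.snd h
    change (Φ.symm (j p)).2 - (constCLM I E (Φ.symm (j p)).1.2
      + volterra E (velocity B A (Φ.symm (j p)).1.1 (Φ.symm (j p)).2)) = 0 at h2
    rw [h1] at h2
    exact sub_eq_zero.1 h2

omit [CompleteSpace V] in
/-- Uniqueness for the linearized equation: if `b` solves the variational equation along a curve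
`a' = A(a) c` in the direction `e` of the parameter `c`, and the fields commute along `a`, then
`b(t) = t A(a(t)) e`. -/
lemma variation_eq_of_commute (B : F →L[ℝ] V →L[ℝ] E) {A : C(E, F)} (hA : ContDiff ℝ ∞ A)
    {c e : V} {x : E} {a b g : C(I, E)} (ha : a = constCLM I E x + volterra E (velocity B A c a))
    (hg : ∀ t, g t = B (fderiv ℝ A (a t) (b t)) c + B (A (a t)) e) (hb : b = volterra E g)
    (hcomm : ∀ t, B (fderiv ℝ A (a t) (B (A (a t)) c)) e =
      B (fderiv ℝ A (a t) (B (A (a t)) e)) c) :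
    b 1 = B (A (a 1)) e := by
  let α : ℝ → E := fun t => x + ∫ s in (0 : ℝ)..t, extendUnit (velocity B A c a) s
  let β : ℝ → E := fun t => ∫ s in (0 : ℝ)..t, extendUnit g s
  have hα : ∀ t : I, α t = a t := fun t => by
    conv_rhs => rw [ha]
    simp [α, volterra_apply]
  have hβ : ∀ t : I, β t = b t := fun t => by
    conv_rhs => rw [hb]
    simp [β, volterra_apply]
  have hα' : ∀ t, HasDerivAt α (extendUnit (velocity B A c a) t) t := fun t =>
    (hasDerivAt_integral_extendUnit _ t).const_add x
  have hβ' : ∀ t, HasDerivAt β (extendUnit g t) t := fun t => hasDerivAt_integral_extendUnit _ t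
  -- `w` solves the homogeneous linear equation `w' = B (DA(a) w) c` with `w 0 = 0`, so it vanishes.
  let w : ℝ → E := fun t => β t - t • B (A (α t)) e
  have hw' : ∀ t : I, HasDerivAt w (B (fderiv ℝ A (a t) (w t)) c) t := by
    intro t
    have h1 : HasDerivAt (fun t => B (A (α t)) e)
        (B (fderiv ℝ A (α t) (extendUnit (velocity B A c a) t)) e) t := by
      have h0 := (hA.differentiable (by simp) (α t)).hasFDerivAt.comp_hasDerivAt (t : ℝ) (hα' t)
      exact (B.flip e).hasFDerivAt.comp_hasDerivAt (t : ℝ) h0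
    have h2 := (hβ' t).sub ((hasDerivAt_id (t : ℝ)).smul h1)
    refine h2.congr_deriv ?_
    simp only [w, hα, hβ, extendUnit_coe, hg, velocity_apply, id, hcomm, map_sub, map_smul,
      sub_apply, smul_apply, one_smul]
    abel
  obtain ⟨C, hC⟩ := isCompact_univ.exists_bound_of_continuousOn (f := fun t : I => fderiv ℝ A (a t))
    ((hA.continuous_fderiv (by simp)).comp a.continuous).continuousOn
  have hw : ∀ t ∈ Icc (0 : ℝ) 1, w t = 0 := by
    refine eq_zero_of_abs_deriv_le_mul_abs_self_of_eq_zero_right (K := ‖B‖ * C * ‖c‖)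
      (f' := fun t => B (fderiv ℝ A (a (projIcc 0 1 zero_le_one t)) (w t)) c) ?_ ?_ ?_ ?_
    · exact fun t ht => (hw' ⟨t, ht⟩).continuousAt.continuousWithinAt
    · intro t ht
      have := hw' ⟨t, Ico_subset_Icc_self ht⟩
      rw [projIcc_of_mem _ (Ico_subset_Icc_self ht)]
      exact this.hasDerivWithinAt
    · simp [w, β]
    · intro t _
      have h1 := hC (projIcc 0 1 zero_le_one t) (mem_univ _)
      calc _ ≤ ‖B‖ * ‖fderiv ℝ A (a (projIcc 0 1 zero_le_one t)) (w t)‖ * ‖c‖ := B.le_opNorm₂ _ _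
        _ ≤ ‖B‖ * (C * ‖w t‖) * ‖c‖ := by
          gcongr
          exact (ContinuousLinearMap.le_opNorm _ _).trans (by gcongr)
        _ = _ := by ring
  have h1 := hw 1 (by simp)
  have hα1 : α 1 = a 1 := hα 1
  have hβ1 : β 1 = b 1 := hβ 1
  simpa [w, hα1, hβ1, sub_eq_zero] using h1

/-- Local solvability of the total differential equation `∂Ψ/∂c = B(A(Ψ))` under the commutation
condition, with smooth dependence on the initial value `Ψ(0, x) = x`. For `V = ℝ` this is the local
flow of a vector field. -/
theorem exists_smooth_multiflow (B : F →L[ℝ] V →L[ℝ] E) {A : E → F} (hA : ContDiff ℝ ∞ A) (x₀ : E)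
    (hcomm : ∀ᶠ x in 𝓝 x₀, ∀ c e,
      B (fderiv ℝ A x (B (A x) c)) e = B (fderiv ℝ A x (B (A x) e)) c) :
    ∃ (P : Set (V × E)) (Ψ : V × E → E), IsOpen P ∧ (0, x₀) ∈ P ∧ ContDiffOn ℝ ∞ Ψ P ∧
      (∀ x, (0, x) ∈ P → Ψ (0, x) = x) ∧
      ∀ p ∈ P, HasFDerivAt (fun c => Ψ (c, p.2)) (B (A (Ψ p))) p.1 := by
  obtain ⟨O, hO, hOo, hxO⟩ := eventually_nhds_iff.1 hcomm
  let A' : C(E, F) := ⟨A, hA.continuous⟩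
  obtain ⟨P, a, hP, hmem, ha, ha0, haP⟩ := exists_smooth_solution B (A := A') hA x₀
  -- The curves that stay in the region where the fields commute form an open set.
  have hopen : IsOpen (P ∩ a ⁻¹' {f : C(I, E) | MapsTo f univ O}) :=
    ha.continuousOn.isOpen_inter_preimage hP
      (ContinuousMap.isOpen_setOfPred_mapsTo isCompact_univ hOo)
  refine ⟨_, fun p => a p 1, hopen, ⟨hmem, ?_⟩, ?_, ?_, ?_⟩
  · rw [mem_preimage, ha0]
    exact fun _ _ => hxO
  · exact (ContinuousMap.evalCLM ℝ (1 : I)).contDiff.comp_contDiffOn (ha.mono inter_subset_left)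
  · intro x hx
    change a (0, x) 1 = x
    rw [haP _ hx.1]
    have : velocity B A' 0 (a (0, x)) = 0 := by ext t; simp [velocity_apply]
    simp [this]
  · rintro ⟨c, x⟩ hp
    -- Differentiating the integral equation in `c` gives the variational equation.
    have haf : HasFDerivAt a (fderiv ℝ a (c, x)) (c, x) :=
      ((ha.contDiffAt (hP.mem_nhds hp.1)).differentiableAt (by simp)).hasFDerivAt
    obtain ⟨D, hD, hD'⟩ := hasFDerivAt_velocity B (A := A') hA
      (hasFDerivAt_fst (𝕜 := ℝ) (p := (c, x))) haf
    have heq : fderiv ℝ a (c, x) = (constCLM I E).comp (ContinuousLinearMap.snd ℝ V E)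
        + (volterra E).comp D := by
      have h1 : HasFDerivAt
          (fun p : V × E => constCLM I E p.2 + volterra E (velocity B A' p.1 (a p)))
          ((constCLM I E).comp (ContinuousLinearMap.snd ℝ V E) + (volterra E).comp D) (c, x) :=
        ((constCLM I E).hasFDerivAt.comp (c, x) hasFDerivAt_snd).add
          ((volterra E).hasFDerivAt.comp (c, x) hD)
      refine (h1.congr_of_eventuallyEq ?_).fderiv
      filter_upwards [hP.mem_nhds hp.1] with q hq using haP q hq
    let ev : C(I, E) →L[ℝ] E := ContinuousMap.evalCLM ℝ (1 : I)
    have h2 : HasFDerivAt (fun c' : V => ev (a (c', x))) (ev.comp ((fderiv ℝ a (c, x)).comp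
          (ContinuousLinearMap.inl ℝ V E))) c :=
      ev.hasFDerivAt.comp c
        (HasFDerivAt.comp c (f := fun c' => (c', x)) (g := a) haf (hasFDerivAt_prodMk_left c x))
    refine h2.congr_fderiv ?_
    ext1 e
    refine variation_eq_of_commute B (A := A') hA (haP _ hp.1) (g := D (e, 0)) (e := e) ?_ ?_ ?_
    · exact fun t => hD' (e, 0) t
    · conv_lhs => rw [heq]
      simp
    · exact fun t => hO _ (hp.2 (mem_univ t)) c e

end Flow

/-! ### The Frobenius theorem in a vector space -/

section Straightening

/-- A map smooth near a point agrees near that point with a globally smooth one. -/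
lemma exists_contDiff_eventuallyEq {E F : Type*} [NormedAddCommGroup E] [NormedSpace ℝ E]
    [HasContDiffBump E] [NormedAddCommGroup F] [NormedSpace ℝ F] {A : E → F} {O : Set E}
    (hO : IsOpen O) (hA : ContDiffOn ℝ ∞ A O) {x₀ : E} (hx₀ : x₀ ∈ O) :
    ∃ A' : E → F, ContDiff ℝ ∞ A' ∧ A' =ᶠ[𝓝 x₀] A := by
  obtain ⟨r, hr, hrO⟩ := Metric.nhds_basis_closedBall.mem_iff.1 (hO.mem_nhds hx₀)
  let f : ContDiffBump x₀ := ⟨r / 2, r, by positivity, by linarith⟩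
  refine ⟨fun x => f x • A x, contDiff_iff_contDiffAt.2 fun x => ?_, ?_⟩
  · by_cases hx : x ∈ O
    · exact f.contDiff.contDiffAt.smul (hA.contDiffAt (hO.mem_nhds hx))
    · have h : (fun x => f x • A x) =ᶠ[𝓝 x] fun _ => 0 := by
        have hx' : x ∈ (tsupport f)ᶜ := fun h => hx (hrO (by rwa [f.tsupport_eq] at h))
        filter_upwards [(isClosed_tsupport f).isOpen_compl.mem_nhds hx'] with y hy
        rw [image_eq_zero_of_notMem_tsupport hy, zero_smul]
      exact contDiffAt_const.congr_of_eventuallyEq h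
  · filter_upwards [f.eventuallyEq_one] with x hx
    simp [hx]

variable {E V W : Type u} [NormedAddCommGroup E] [NormedSpace ℝ E]
  [NormedAddCommGroup V] [NormedSpace ℝ V] [NormedAddCommGroup W] [NormedSpace ℝ W]

/-- A frame `A` of an involutive distribution that is a right inverse of a fixed linear map `π` is
commuting. Here `X = A ∘ B` is an arbitrary frame, and `A` is the frame adapted to `π`. -/
lemma commute_of_involutive {X A : E → V →L[ℝ] E} {B : E → V →L[ℝ] V} {π : E →L[ℝ] V} {x : E}
    (hA : DifferentiableAt ℝ A x) (hB : DifferentiableAt ℝ B x)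
    (hX : X =ᶠ[𝓝 x] fun y => (A y).comp (B y)) (hπ : ∀ᶠ y in 𝓝 x, ∀ c, π (A y c) = c)
    (hsurj : Function.Surjective (B x))
    (hinv : ∀ c e, ∃ v, fderiv ℝ X x (X x c) e - fderiv ℝ X x (X x e) c = X x v) (c e : V) :
    fderiv ℝ A x (A x c) e = fderiv ℝ A x (A x e) c := by
  have hπ' : ∀ u c, π (fderiv ℝ A x u c) = 0 := by
    intro u c
    have h1 := (π.hasFDerivAt.comp x (hA.hasFDerivAt.clm_apply (hasFDerivAt_const c x)))
    have h2 : (π ∘ fun y => A y c) =ᶠ[𝓝 x] fun _ => c := by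
      filter_upwards [hπ] with y hy using hy c
    have h3 := (h1.congr_of_eventuallyEq h2.symm).unique (hasFDerivAt_const c x)
    simpa using DFunLike.congr_fun h3 u
  have hXx : X x = (A x).comp (B x) := hX.self_of_nhds
  have hX' : ∀ u v, fderiv ℝ X x u v = fderiv ℝ A x u (B x v) + A x (fderiv ℝ B x u v) := by
    intro u v
    rw [((hA.hasFDerivAt.clm_comp hB.hasFDerivAt).congr_of_eventuallyEq hX).fderiv]
    simp [add_comm]
  obtain ⟨c, rfl⟩ := hsurj c
  obtain ⟨e, rfl⟩ := hsurj e
  obtain ⟨v, hv⟩ := hinv c e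
  simp only [hX', hXx, ContinuousLinearMap.comp_apply] at hv
  have hπx := hπ.self_of_nhds
  -- Applying `π` shows that the component of the bracket along the distribution vanishes.
  have hv' := congrArg π hv
  simp only [map_sub, map_add, hπ', hπx, zero_add] at hv'
  have hv'' := congrArg (A x) hv'
  rw [map_sub] at hv''
  rw [← sub_eq_zero]
  rw [add_sub_add_comm, hv''] at hv
  exact add_eq_right.1 hv

variable [CompleteSpace E] [HasContDiffBump E] [CompleteSpace V] [CompleteSpace W]

omit [CompleteSpace E] in
/-- The frame of a distribution that is adapted to a linear projection `π`. -/
lemma exists_adapted_frame {X : E → V →L[ℝ] E} {O : Set E} (hO : IsOpen O)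
    (hX : ContDiffOn ℝ ∞ X O) {x₀ : E} (hx₀ : x₀ ∈ O) {π : E →L[ℝ] V}
    (hπ : ∀ v, π (X x₀ v) = v)
    (hinv : ∀ x ∈ O, ∀ c e, ∃ v, fderiv ℝ X x (X x c) e - fderiv ℝ X x (X x e) c = X x v) :
    ∃ (A : E → V →L[ℝ] E) (O' : Set E), ContDiff ℝ ∞ A ∧ IsOpen O' ∧ x₀ ∈ O' ∧ O' ⊆ O ∧
      (∀ v, A x₀ v = X x₀ v) ∧
      ∀ x ∈ O', (∀ c e, fderiv ℝ A x (A x c) e = fderiv ℝ A x (A x e) c) ∧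
        (∀ v, ∃ c, X x v = A x c) ∧ ∀ c, ∃ v, A x c = X x v := by
  let B : E → V →L[ℝ] V := fun x => π.comp (X x)
  have hB : ContDiffOn ℝ ∞ B O := contDiffOn_const.clm_comp hX
  have hB0 : B x₀ = ContinuousLinearEquiv.refl ℝ V := by
    ext v
    simp [B, hπ]
  let O₁ : Set E := O ∩ B ⁻¹' range ((↑) : (V ≃L[ℝ] V) → V →L[ℝ] V)
  have hO₁ : IsOpen O₁ := hB.continuousOn.isOpen_inter_preimage hO ContinuousLinearEquiv.isOpen
  have hx₁ : x₀ ∈ O₁ := ⟨hx₀, _, hB0.symm⟩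
  -- `A₁ x` is the inverse of the restriction of `π` to the distribution at `x`.
  let A₁ : E → V →L[ℝ] E := fun x => (X x).comp (B x).inverse
  have hA₁ : ContDiffOn ℝ ∞ A₁ O₁ := by
    refine (hX.mono inter_subset_left).clm_comp ?_
    rintro x ⟨hxO, g, hg⟩
    have h1 : ContDiffAt ℝ ∞ ContinuousLinearMap.inverse (B x) := by
      rw [← hg]
      exact contDiffAt_map_inverse g
    exact (h1.comp x (hB.contDiffAt (hO.mem_nhds hxO))).contDiffWithinAt
  obtain ⟨A, hA, hAA₁⟩ := exists_contDiff_eventuallyEq hO₁ hA₁ hx₁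
  obtain ⟨O₂, hO₂, hO₂o, hx₂⟩ := eventually_nhds_iff.1 hAA₁
  have hfact : ∀ x ∈ O₁ ∩ O₂, X x = (A x).comp (B x) ∧ (∀ c, π (A x c) = c) ∧
      Function.Surjective (B x) := by
    rintro x ⟨⟨-, g, hg⟩, hx2⟩
    rw [hO₂ x hx2]
    refine ⟨?_, ?_, hg ▸ g.surjective⟩
    · ext v
      simp [A₁, ← hg]
    · intro c
      change B x ((B x).inverse c) = c
      simp [← hg]
  have hopen : IsOpen (O₁ ∩ O₂) := hO₁.inter hO₂o
  refine ⟨A, O₁ ∩ O₂, hA, hopen, ⟨hx₁, hx₂⟩, fun x hx => hx.1.1, ?_, fun x hx => ⟨?_, ?_, ?_⟩⟩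
  · intro v
    rw [(hfact x₀ ⟨hx₁, hx₂⟩).1, hB0]
    simp
  · refine commute_of_involutive (X := X) (B := B) (π := π) (hA.differentiable (by simp) x)
      ((hB.contDiffAt (hO.mem_nhds hx.1.1)).differentiableAt (by simp)) ?_ ?_ (hfact x hx).2.2
      (hinv x hx.1.1)
    · filter_upwards [hopen.mem_nhds hx] with y hy using (hfact y hy).1
    · filter_upwards [hopen.mem_nhds hx] with y hy using (hfact y hy).2.1
  · exact fun v => ⟨B x v, by rw [(hfact x hx).1]; rfl⟩
  · intro c
    obtain ⟨v, rfl⟩ := (hfact x hx).2.2 c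
    exact ⟨v, by rw [(hfact x hx).1]; rfl⟩

/-- The local Frobenius theorem in a vector space: an involutive distribution, given by a smooth
frame `X`, is mapped to `V × 0` by a smooth local change of coordinates. -/
theorem exists_straightening {X : E → V →L[ℝ] E} {O : Set E} (hO : IsOpen O)
    (hX : ContDiffOn ℝ ∞ X O) {x₀ : E} (hx₀ : x₀ ∈ O) (L : E ≃L[ℝ] V × W)
    (hL : ∀ v, L (X x₀ v) = (v, 0))
    (hinv : ∀ x ∈ O, ∀ c e, ∃ v, fderiv ℝ X x (X x c) e - fderiv ℝ X x (X x e) c = X x v) :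
    ∃ (r : ℝ) (Φ : OpenPartialHomeomorph (V × W) E), 0 < r ∧
      Φ.source = Metric.ball 0 r ×ˢ Metric.ball 0 r ∧ Φ 0 = x₀ ∧ Φ.target ⊆ O ∧
      ContDiffOn ℝ ∞ Φ Φ.source ∧ ContDiffOn ℝ ∞ Φ.symm Φ.target ∧
      ∀ p ∈ Φ.source, (∀ v, ∃ c, X (Φ p) v = fderiv ℝ Φ p (c, 0)) ∧
        ∀ c, ∃ v, fderiv ℝ Φ p (c, 0) = X (Φ p) v := by
  obtain ⟨A, O', hA, hO', hx', hO'O, hA0, hAO'⟩ := exists_adapted_frame hO hX hx₀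
    (π := (ContinuousLinearMap.fst ℝ V W).comp (L : E →L[ℝ] V × W)) (by simp [hL]) hinv
  obtain ⟨P, Ψ, hP, hmem, hΨ, hΨ0, hΨP⟩ := exists_smooth_multiflow
    (ContinuousLinearMap.id ℝ (V →L[ℝ] E)) hA x₀ (by
      filter_upwards [hO'.mem_nhds hx'] with x hx using (hAO' x hx).1)
  -- The flow starts from the transversal `x₀ + L⁻¹(0 × W)`.
  let j : V × W → V × E := fun p => (p.1, x₀ + L.symm (0, p.2))
  have hj : ContDiff ℝ ∞ j := contDiff_fst.prodMk
    (contDiff_const.add (L.symm.contDiff.comp (contDiff_const.prodMk contDiff_snd)))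
  have hj0 : j 0 = (0, x₀) := by
    have : L.symm ((0 : V), (0 : W)) = 0 := map_zero L.symm
    simp [j, this]
  let Θ : V × W → E := fun p => Ψ (j p)
  let s : Set (V × W) := j ⁻¹' (P ∩ Ψ ⁻¹' O')
  have hs : IsOpen s :=
    (hΨ.continuousOn.isOpen_inter_preimage hP hO').preimage hj.continuous
  have h0s : (0 : V × W) ∈ s := by
    refine ⟨by rwa [hj0], ?_⟩
    rw [mem_preimage, hj0, hΨ0 _ hmem]
    exact hx'
  have hΘ : ContDiffOn ℝ ∞ Θ s := hΨ.comp hj.contDiffOn fun p hp => hp.1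
  have hΘs : ∀ p ∈ s, HasFDerivAt Θ (fderiv ℝ Θ p) p := fun p hp =>
    ((hΘ.contDiffAt (hs.mem_nhds hp)).differentiableAt (by simp)).hasFDerivAt
  have hΘc : ∀ p ∈ s, ∀ c, fderiv ℝ Θ p (c, 0) = A (Θ p) c := by
    intro p hp c
    have h1 := HasFDerivAt.comp p.1 (f := fun c => (c, p.2)) (g := Θ) (hΘs p hp)
      (hasFDerivAt_prodMk_left p.1 p.2)
    have h2 := h1.unique (hΨP (j p) hp.1)
    simpa using DFunLike.congr_fun h2 c
  have hΘ0 : Θ 0 = x₀ := by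
    change Ψ (j 0) = x₀
    rw [hj0, hΨ0 _ hmem]
  have hΘ' : HasFDerivAt Θ (L.symm : V × W →L[ℝ] E) 0 := by
    refine (hΘs 0 h0s).congr_fderiv (ContinuousLinearMap.ext fun p => ?_)
    have hc : fderiv ℝ Θ 0 (p.1, 0) = L.symm (p.1, 0) := by
      rw [hΘc 0 h0s, hΘ0, hA0, ← hL, L.symm_apply_apply]
    have hy : fderiv ℝ Θ 0 (0, p.2) = L.symm (0, p.2) := by
      have h1 := HasFDerivAt.comp (0 : W) (f := fun y => ((0 : V), y)) (g := Θ) (hΘs 0 h0s)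
        (hasFDerivAt_prodMk_right 0 0)
      have h2 : HasFDerivAt (fun y : W => x₀ + L.symm (0, y))
          ((L.symm : V × W →L[ℝ] E).comp (ContinuousLinearMap.inr ℝ V W)) 0 :=
        (L.symm.hasFDerivAt.comp (0 : W) (hasFDerivAt_prodMk_right 0 0)).const_add x₀
      have h3 : (Θ ∘ fun y : W => ((0 : V), y)) =ᶠ[𝓝 0] fun y => x₀ + L.symm (0, y) := by
        have : Continuous fun y : W => ((0 : V), y) := by fun_prop
        filter_upwards [(hs.preimage this).mem_nhds h0s] with y hy
        exact hΨ0 _ hy.1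
      simpa using DFunLike.congr_fun (h1.unique (h2.congr_of_eventuallyEq h3)) p.2
    have hp : p = (p.1, 0) + (0, p.2) := by simp
    rw [hp, map_add, hc, hy, ContinuousLinearEquiv.coe_coe, map_add]
  obtain ⟨Φ, hΦ, hΦ0, hΦs, hΦsymm⟩ := exists_smooth_openPartialHomeomorph hs hΘ h0s hΘ'
  obtain ⟨r, hr, hrΦ⟩ := Metric.mem_nhds_iff.1 (Φ.open_source.mem_nhds hΦ0)
  have hball : Metric.ball (0 : V × W) r = Metric.ball 0 r ×ˢ Metric.ball 0 r :=
    (ball_prod_same 0 0 r).symm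
  refine ⟨r, Φ.restrOpen (Metric.ball 0 r) Metric.isOpen_ball, hr, ?_, ?_, ?_, ?_, ?_, ?_⟩
  · rw [← hball]
    exact inter_eq_right.2 hrΦ
  · change Φ 0 = x₀
    rw [hΦ, hΘ0]
  · intro x hx
    have h1 := hΦs (Φ.map_target hx.1)
    have h2 := hO'O h1.2
    change Θ (Φ.symm x) ∈ O at h2
    rwa [← hΦ, Φ.right_inv hx.1] at h2
  · change ContDiffOn ℝ ∞ Φ _
    rw [hΦ]
    exact hΘ.mono fun p hp => hΦs hp.1
  · exact hΦsymm.mono fun x hx => hx.1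
  · intro p hp
    change (∀ v, ∃ c, X (Φ p) v = fderiv ℝ Φ p (c, 0)) ∧ ∀ c, ∃ v, fderiv ℝ Φ p (c, 0) = X (Φ p) v
    have hps := hΦs hp.1
    rw [hΦ]
    simp only [hΘc p hps]
    exact (hAO' _ hps.2).2

end Straightening

/-! ### Orbits of spanning families of vector fields -/

section Orbits

variable {V : Type u} [NormedAddCommGroup V] [NormedSpace ℝ V] [CompleteSpace V]
  [HasContDiffBump V]

/-- The local flow of a smooth vector field, with its derivative at `(0, x)`. -/
lemma exists_local_flow {b : V → V} {S : Set V} (hS : IsOpen S) (hb : ContDiffOn ℝ ∞ b S) {x : V}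
    (hx : x ∈ S) :
    ∃ (Ψ : ℝ × V → V) (D : ℝ × V →L[ℝ] V), HasStrictFDerivAt Ψ D (0, x) ∧
      (∀ t v, D (t, v) = t • b x + v) ∧ Ψ (0, x) = x ∧
      ∀ᶠ p in 𝓝 ((0 : ℝ), x), Ψ (0, p.2) = p.2 ∧ ∀ t ∈ uIcc 0 p.1,
        Ψ (t, p.2) ∈ S ∧ HasDerivAt (fun t => Ψ (t, p.2)) (b (Ψ (t, p.2))) t := by
  obtain ⟨A, hA, hAb⟩ := exists_contDiff_eventuallyEq hS hb hx
  obtain ⟨O, hO, hOo, hxO⟩ := eventually_nhds_iff.1 hAb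
  obtain ⟨P, Ψ, hP, hmem, hΨ, hΨ0, hΨP⟩ := exists_smooth_multiflow
    (ContinuousLinearMap.lsmul ℝ ℝ).flip hA x (Eventually.of_forall fun y c e => by
      simp [smul_comm c e])
  have hΨx : Ψ (0, x) = x := hΨ0 x hmem
  have hopen : IsOpen (P ∩ Ψ ⁻¹' (O ∩ S)) :=
    hΨ.continuousOn.isOpen_inter_preimage hP (hOo.inter hS)
  have hmem' : (0, x) ∈ P ∩ Ψ ⁻¹' (O ∩ S) := ⟨hmem, by simpa [hΨx] using ⟨hxO, hx⟩⟩
  have hderiv : ∀ p ∈ P ∩ Ψ ⁻¹' (O ∩ S), HasDerivAt (fun t => Ψ (t, p.2)) (b (Ψ p)) p.1 := by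
    intro p hp
    have h := (hΨP p hp.1).hasDerivAt
    rwa [ContinuousLinearMap.flip_apply, ContinuousLinearMap.lsmul_apply, one_smul,
      hO _ hp.2.1] at h
  have hcd := hΨ.contDiffAt (hP.mem_nhds hmem)
  have hfd := (hcd.differentiableAt (by simp)).hasFDerivAt
  refine ⟨Ψ, fderiv ℝ Ψ (0, x), hcd.hasStrictFDerivAt (by simp), ?_, hΨx, ?_⟩
  · have h1 : ∀ t, fderiv ℝ Ψ (0, x) (t, 0) = t • b x := by
      intro t
      have h2 := HasFDerivAt.comp (0 : ℝ) (f := fun t => (t, x)) (g := Ψ) hfd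
        (hasFDerivAt_prodMk_left 0 x)
      have h3 := h2.unique (hderiv _ hmem').hasFDerivAt
      simpa [hΨx] using DFunLike.congr_fun h3 t
    have h1' : ∀ v, fderiv ℝ Ψ (0, x) (0, v) = v := by
      intro v
      have h2 := HasFDerivAt.comp x (f := fun y => ((0 : ℝ), y)) (g := Ψ) hfd
        (hasFDerivAt_prodMk_right 0 x)
      have h3 : (Ψ ∘ fun y => ((0 : ℝ), y)) =ᶠ[𝓝 x] id := by
        have : Continuous fun y : V => ((0 : ℝ), y) := by fun_prop
        filter_upwards [(hP.preimage this).mem_nhds hmem] with y hy using hΨ0 y hy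
      simpa using DFunLike.congr_fun (h2.unique ((hasFDerivAt_id x).congr_of_eventuallyEq h3)) v
    intro t v
    have : (t, v) = (t, 0) + (0, v) := by simp
    rw [this, map_add, h1, h1']
  · obtain ⟨δ, hδ, hsub⟩ := Metric.mem_nhds_iff.1 (hopen.mem_nhds hmem')
    rw [← ball_prod_same] at hsub
    filter_upwards [Metric.ball_mem_nhds ((0 : ℝ), x) hδ] with p hp
    rw [← ball_prod_same] at hp
    refine ⟨hΨ0 _ (hsub (mk_mem_prod (Metric.mem_ball_self hδ) hp.2)).1, fun t ht => ?_⟩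
    have ht' : t ∈ Metric.ball (0 : ℝ) δ :=
      (convex_ball (0 : ℝ) δ).ordConnected.uIcc_subset (Metric.mem_ball_self hδ) hp.1 ht
    have h := hsub (mk_mem_prod ht' hp.2)
    exact ⟨h.2.2, hderiv _ h⟩

variable {ι : Type*} [Fintype ι]

/-- A set is invariant under the fields `b k` on `S` if no integral curve in `S` of one of these
fields has one endpoint in the set and the other one outside. -/
def IsFlowInvariant (b : ι → V → V) (S T : Set V) : Prop :=
  ∀ (k : ι) (γ : ℝ → V) (τ : ℝ), (∀ t ∈ uIcc 0 τ, γ t ∈ S ∧ HasDerivAt γ (b k (γ t)) t) →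
    (γ 0 ∈ T ↔ γ τ ∈ T)

/-- Composing the flows of several fields gives a map `G` of the times, whose derivative at `0`
is the linear combination of the fields. -/
lemma exists_composed_flow {b : ι → V → V} {S T : Set V} (hS : IsOpen S)
    (hb : ∀ k, ContDiffOn ℝ ∞ (b k) S) (hT : IsFlowInvariant b S T) {x : V} (hx : x ∈ S)
    (s : Finset ι) :
    ∃ (G : (ι → ℝ) → V) (D : (ι → ℝ) →L[ℝ] V), HasStrictFDerivAt G D 0 ∧ G 0 = x ∧
      (∀ t, D t = ∑ k ∈ s, t k • b k x) ∧ ∀ᶠ t in 𝓝 0, (x ∈ T ↔ G t ∈ T) := by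
  classical
  induction s using Finset.induction_on with
  | empty => exact ⟨fun _ => x, 0, hasStrictFDerivAt_const x 0, rfl, by simp, by simp⟩
  | insert k s hk ih =>
    obtain ⟨G, D, hG, hG0, hD, hGT⟩ := ih
    obtain ⟨Ψ, DΨ, hΨ, hDΨ, hΨ0, hΨT⟩ := exists_local_flow hS (hb k) hx
    have hpair : HasStrictFDerivAt (fun t : ι → ℝ => (t k, G t))
        ((ContinuousLinearMap.proj k).prod D) 0 :=
      (ContinuousLinearMap.proj (R := ℝ) (φ := fun _ : ι => ℝ) k).hasStrictFDerivAt.prodMk hG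
    have hpair0 : ((0 : ι → ℝ) k, G 0) = (0, x) := by simp [hG0]
    refine ⟨fun t => Ψ (t k, G t), DΨ.comp ((ContinuousLinearMap.proj k).prod D), ?_, ?_, ?_, ?_⟩
    · exact HasStrictFDerivAt.comp (g := Ψ) (0 : ι → ℝ) (by rwa [hpair0]) hpair
    · simp [hG0, hΨ0]
    · intro t
      simp [hDΨ, hD, Finset.sum_insert hk]
    · have htend : Tendsto (fun t : ι → ℝ => (t k, G t)) (𝓝 0) (𝓝 (0, x)) := by
        have := hpair.continuousAt.tendsto
        rwa [hpair0] at this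
      filter_upwards [hGT, htend.eventually hΨT] with t h1 h2
      have h3 := hT k (fun τ => Ψ (τ, G t)) (t k) h2.2
      simp only [h2.1] at h3
      exact h1.trans h3

/-- If the fields span everywhere, then a subset of a connected open set that is invariant under
their flows is everything or nothing: the orbit of a point is open by the inverse function
theorem. -/
theorem IsFlowInvariant.mem_iff {b : ι → V → V} {S T : Set V} (hS : IsOpen S)
    (hconn : IsPreconnected S) (hb : ∀ k, ContDiffOn ℝ ∞ (b k) S)
    (hspan : ∀ x ∈ S, Submodule.span ℝ (range fun k => b k x) = ⊤)
    (hT : IsFlowInvariant b S T) {x y : V} (hx : x ∈ S) (hy : y ∈ S) : x ∈ T ↔ y ∈ T := by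
  classical
  have hloc : ∀ z ∈ S, ∀ᶠ w in 𝓝 z, (z ∈ T ↔ w ∈ T) := by
    intro z hz
    obtain ⟨G, D, hG, hG0, hD, hGT⟩ := exists_composed_flow hS hb hT hz Finset.univ
    have hsurj : D.range = ⊤ := by
      rw [eq_top_iff, ← hspan z hz]
      refine fun v hv => ?_
      obtain ⟨c, hc⟩ := (Submodule.mem_span_range_iff_exists_fun ℝ).1 hv
      exact ⟨c, (hD c).trans hc⟩
    rw [← hG0, ← hG.map_nhds_eq_of_surj hsurj, hG0]
    exact hGT
  have hcont : ContinuousOn (fun z => decide (z ∈ T)) S := by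
    intro z hz
    refine ContinuousAt.continuousWithinAt ?_
    refine (continuousAt_const (y := decide (z ∈ T))).congr ?_
    filter_upwards [hloc z hz] with w hw
    simp [hw]
  simpa using hconn.constant hcont hx hy

end Orbits

/-! ### Vector fields in coordinates -/

section Pushforward

open VectorField

variable {d : ℕ} {M : Type*} [TopologicalSpace M] [ChartedSpace (EuclideanSpace ℝ (Fin d)) M]
  {F : Type*} [NormedAddCommGroup F] [NormedSpace ℝ F]

/-- The vector field `X` on a manifold, written in the coordinates `κ`. -/
noncomputable def inCoordinates (κ : OpenPartialHomeomorph M F)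
    (X : (s : M) → TangentSpace (𝓡 d) s) (x : F) : F :=
  mfderiv (𝓡 d) 𝓘(ℝ, F) κ (κ.symm x) (X (κ.symm x))

lemma inCoordinates_apply {κ : OpenPartialHomeomorph M F} (X : (s : M) → TangentSpace (𝓡 d) s)
    {s : M} (hs : s ∈ κ.source) :
    inCoordinates κ X (κ s) = mfderiv (𝓡 d) 𝓘(ℝ, F) κ s (X s) := by
  exact congrArg (fun s => (mfderiv (𝓡 d) 𝓘(ℝ, F) κ s (X s) : F)) (κ.left_inv hs)

/-- Smooth coordinates on an open subset of a manifold, with values in a normed space. -/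
structure IsSmoothCoordinates (d : ℕ) {M : Type*} [TopologicalSpace M]
    [ChartedSpace (EuclideanSpace ℝ (Fin d)) M] {F : Type*} [NormedAddCommGroup F]
    [NormedSpace ℝ F] (κ : OpenPartialHomeomorph M F) : Prop where
  contMDiffOn : ContMDiffOn (𝓡 d) 𝓘(ℝ, F) ∞ κ κ.source
  contMDiffOn_symm : ContMDiffOn 𝓘(ℝ, F) (𝓡 d) ∞ κ.symm κ.target

namespace IsSmoothCoordinates

variable {κ : OpenPartialHomeomorph M F}

lemma mdifferentiable (hκ : IsSmoothCoordinates d κ) : κ.MDifferentiable (𝓡 d) 𝓘(ℝ, F) :=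
  ⟨hκ.contMDiffOn.mdifferentiableOn (by simp), hκ.contMDiffOn_symm.mdifferentiableOn (by simp)⟩

lemma mfderiv_symm_isInvertible (hκ : IsSmoothCoordinates d κ) {x : F} (hx : x ∈ κ.target) :
    (mfderiv 𝓘(ℝ, F) (𝓡 d) κ.symm x).IsInvertible :=
  ⟨hκ.mdifferentiable.symm.mfderiv hx, rfl⟩

lemma mpullback_symm (hκ : IsSmoothCoordinates d κ) (X : (s : M) → TangentSpace (𝓡 d) s) {x : F}
    (hx : x ∈ κ.target) : mpullback 𝓘(ℝ, F) (𝓡 d) κ.symm X x = inCoordinates κ X x := by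
  rw [mpullback_apply]
  have h : mfderiv 𝓘(ℝ, F) (𝓡 d) κ.symm x
      = (hκ.mdifferentiable.symm.mfderiv hx : TangentSpace 𝓘(ℝ, F) x →L[ℝ] _) := rfl
  rw [h, ContinuousLinearMap.inverse_equiv]
  rfl

variable [IsManifold (𝓡 d) ∞ M] [CompleteSpace F]

lemma contDiffOn_inCoordinates (hκ : IsSmoothCoordinates d κ) {X : (s : M) → TangentSpace (𝓡 d) s}
    {Ω : Set M} (hΩ : IsOpen Ω) (hX : ContMDiffOn (𝓡 d) (𝓡 d).tangent ∞
      (fun s => (⟨s, X s⟩ : TangentBundle (𝓡 d) M)) Ω) :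
    ContDiffOn ℝ ∞ (inCoordinates κ X) (κ.target ∩ κ.symm ⁻¹' Ω) := by
  rintro x ⟨hx, hxΩ⟩
  have : IsManifold (𝓡 d) 1 M := IsManifold.of_le (n := ∞) (by simp)
  have h := ContMDiffAt.mpullback_vectorField_preimage (n := ∞) (m := ∞)
    (hX.contMDiffAt (hΩ.mem_nhds hxΩ))
    (hκ.contMDiffOn_symm.contMDiffAt (κ.open_target.mem_nhds hx))
    (hκ.mfderiv_symm_isInvertible hx) (by simp)
  refine ((contMDiffAt_vectorSpace_iff_contDiffAt.1 h).congr_of_eventuallyEq ?_).contDiffWithinAt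
  filter_upwards [κ.open_target.mem_nhds hx] with y hy using (hκ.mpullback_symm X hy).symm

lemma lieBracket_inCoordinates (hκ : IsSmoothCoordinates d κ)
    {X Y : (s : M) → TangentSpace (𝓡 d) s} {Ω : Set M} (hΩ : IsOpen Ω)
    (hX : ContMDiffOn (𝓡 d) (𝓡 d).tangent ∞ (fun s => (⟨s, X s⟩ : TangentBundle (𝓡 d) M)) Ω)
    (hY : ContMDiffOn (𝓡 d) (𝓡 d).tangent ∞ (fun s => (⟨s, Y s⟩ : TangentBundle (𝓡 d) M)) Ω)
    {x : F} (hx : x ∈ κ.target) (hxΩ : κ.symm x ∈ Ω) :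
    lieBracket ℝ (inCoordinates κ X) (inCoordinates κ Y) x =
      inCoordinates κ (mlieBracket (𝓡 d) X Y) x := by
  have : IsManifold (𝓡 d) (minSmoothness ℝ 3) M :=
    IsManifold.of_le (n := ∞) (by simpa using WithTop.coe_le_coe.2 (le_top : (3 : ℕ∞) ≤ ⊤))
  have h := mpullback_mlieBracket (I := 𝓘(ℝ, F)) (n := ∞) (f := κ.symm) (x₀ := x)
    ((hX.contMDiffAt (hΩ.mem_nhds hxΩ)).mdifferentiableAt (by simp))
    ((hY.contMDiffAt (hΩ.mem_nhds hxΩ)).mdifferentiableAt (by simp))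
    (hκ.contMDiffOn_symm.contMDiffAt (κ.open_target.mem_nhds hx))
    (by simpa using WithTop.coe_le_coe.2 (le_top : (2 : ℕ∞) ≤ ⊤))
  rw [← hκ.mpullback_symm _ hx, h]
  refine Eq.trans ?_ ((congrFun mlieBracketWithin_eq_lieBracketWithin x).trans
    (congrFun lieBracketWithin_univ x)).symm
  refine Filter.EventuallyEq.lieBracket_vectorField_eq ?_ ?_ <;>
  filter_upwards [κ.open_target.mem_nhds hx] with y hy using (hκ.mpullback_symm _ hy).symm

end IsSmoothCoordinates

end Pushforward

/-! ### Frames -/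

section Frame

open VectorField

variable {K : ℕ} {E : Type*} [NormedAddCommGroup E] [NormedSpace ℝ E]

/-- The linear map with values `Y 1 x, …, Y K x` on the standard basis. -/
noncomputable def frame (Y : Fin K → E → E) (x : E) : EuclideanSpace ℝ (Fin K) →L[ℝ] E :=
  ∑ k, (EuclideanSpace.proj k : EuclideanSpace ℝ (Fin K) →L[ℝ] ℝ).smulRight (Y k x)

lemma frame_apply (Y : Fin K → E → E) (x : E) (c : EuclideanSpace ℝ (Fin K)) :
    frame Y x c = ∑ k, c k • Y k x := by
  simp [frame]

lemma exists_frame_eq_iff {Y : Fin K → E → E} {x u : E} :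
    (∃ c, frame Y x c = u) ↔ u ∈ Submodule.span ℝ (range fun k => Y k x) := by
  rw [Submodule.mem_span_range_iff_exists_fun]
  constructor
  · rintro ⟨c, rfl⟩
    exact ⟨c, (frame_apply Y x c).symm⟩
  · rintro ⟨c, rfl⟩
    exact ⟨WithLp.toLp 2 c, frame_apply Y x _⟩

lemma injective_frame {Y : Fin K → E → E} {x : E} (h : LinearIndependent ℝ fun k => Y k x) :
    Function.Injective (frame Y x) := by
  refine (injective_iff_map_eq_zero _).2 fun c hc => ?_
  rw [frame_apply] at hc
  ext k
  exact Fintype.linearIndependent_iff.1 h c hc k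

lemma contDiffOn_frame {Y : Fin K → E → E} {O : Set E} (hY : ∀ k, ContDiffOn ℝ ∞ (Y k) O) :
    ContDiffOn ℝ ∞ (frame Y) O :=
  ContDiffOn.sum fun k _ => contDiffOn_const.smulRight (hY k)

lemma fderiv_frame_apply {Y : Fin K → E → E} {x : E} (hY : ∀ k, DifferentiableAt ℝ (Y k) x)
    (u : E) (c : EuclideanSpace ℝ (Fin K)) :
    fderiv ℝ (frame Y) x u c = ∑ k, c k • fderiv ℝ (Y k) x u := by
  have h : HasFDerivAt (frame Y) (∑ k, (ContinuousLinearMap.smulRightL ℝ _ E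
      (EuclideanSpace.proj k : EuclideanSpace ℝ (Fin K) →L[ℝ] ℝ)).comp (fderiv ℝ (Y k) x)) x :=
    HasFDerivAt.fun_sum fun k _ => (ContinuousLinearMap.smulRightL ℝ _ E
      (EuclideanSpace.proj k : EuclideanSpace ℝ (Fin K) →L[ℝ] ℝ)).hasFDerivAt.comp x
        (hY k).hasFDerivAt
  rw [h.fderiv]
  simp

/-- Involutivity of the fields, in terms of the derivative of their frame. -/
lemma exists_fderiv_frame_sub_eq {Y : Fin K → E → E} {x : E}
    (hY : ∀ k, DifferentiableAt ℝ (Y k) x)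
    (hinv : ∀ i j, lieBracket ℝ (Y i) (Y j) x ∈ Submodule.span ℝ (range fun k => Y k x))
    (c e : EuclideanSpace ℝ (Fin K)) :
    ∃ v, fderiv ℝ (frame Y) x (frame Y x c) e - fderiv ℝ (frame Y) x (frame Y x e) c
      = frame Y x v := by
  suffices h : fderiv ℝ (frame Y) x (frame Y x c) e - fderiv ℝ (frame Y) x (frame Y x e) c
      = ∑ i, ∑ j, (c i * e j) • lieBracket ℝ (Y i) (Y j) x by
    obtain ⟨v, hv⟩ := exists_frame_eq_iff.2 (Submodule.sum_mem _ fun i _ =>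
      Submodule.sum_mem _ fun j _ => Submodule.smul_mem _ (c i * e j) (hinv i j))
    exact ⟨v, h.trans hv.symm⟩
  simp only [fderiv_frame_apply hY]
  simp only [frame_apply, map_sum, map_smul, lieBracket, smul_sub, Finset.sum_sub_distrib,
    Finset.smul_sum, smul_smul]
  congr 1
  · rw [Finset.sum_comm]
    simp only [mul_comm]

/-- An injective linear map is the inclusion of a factor, in suitable linear coordinates. -/
lemma exists_linearEquiv_prod {V E W : Type*} [NormedAddCommGroup V] [NormedSpace ℝ V]
    [NormedAddCommGroup E] [NormedSpace ℝ E] [NormedAddCommGroup W] [NormedSpace ℝ W]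
    [FiniteDimensional ℝ V] [FiniteDimensional ℝ E] [FiniteDimensional ℝ W] {f : V →L[ℝ] E}
    (hf : Function.Injective f)
    (hdim : Module.finrank ℝ E = Module.finrank ℝ V + Module.finrank ℝ W) :
    ∃ L : E ≃L[ℝ] V × W, ∀ v, L (f v) = (v, 0) := by
  obtain ⟨q, hq⟩ := Submodule.exists_isCompl (LinearMap.range f.toLinearMap)
  have hfr := Submodule.finrank_add_eq_of_isCompl hq
  rw [LinearMap.finrank_range_of_inj hf, hdim, add_right_inj] at hfr
  let e₁ : V ≃ₗ[ℝ] LinearMap.range f.toLinearMap := LinearEquiv.ofInjective f.toLinearMap hf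
  let e₂ : W ≃ₗ[ℝ] q := (LinearEquiv.ofFinrankEq q W hfr).symm
  let L := ((e₁.prodCongr e₂).trans (Submodule.prodEquivOfIsCompl _ _ hq)).symm
  refine ⟨L.toContinuousLinearEquiv, fun v => ?_⟩
  change L (f v) = _
  rw [LinearEquiv.symm_apply_eq]
  simp [e₁]

end Frame

/-! ### Flat charts -/

section FlatChart

open VectorField

variable {d K : ℕ} {M : Type*} [TopologicalSpace M] [ChartedSpace (EuclideanSpace ℝ (Fin d)) M]

lemma IsSmoothCoordinates.mem_distributionSpan_iff {F : Type*} [NormedAddCommGroup F]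
    [NormedSpace ℝ F] {κ : OpenPartialHomeomorph M F} (hκ : IsSmoothCoordinates d κ)
    (X : Fin K → (s : M) → TangentSpace (𝓡 d) s) {s : M} (hs : s ∈ κ.source)
    (v : TangentSpace (𝓡 d) s) :
    v ∈ distributionSpan X s ↔ (mfderiv (𝓡 d) 𝓘(ℝ, F) κ s v : F) ∈
      Submodule.span ℝ (range fun k => inCoordinates κ (X k) (κ s)) := by
  let e : TangentSpace (𝓡 d) s ≃ₗ[ℝ] F := (hκ.mdifferentiable.mfderiv hs).toLinearEquiv
  have h : Submodule.span ℝ (range fun k => inCoordinates κ (X k) (κ s))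
      = (distributionSpan X s).map e.toLinearMap := by
    rw [distributionSpan, Submodule.map_span, ← range_comp]
    congr 2
    funext k
    exact inCoordinates_apply (X k) hs
  rw [h]
  have h' := Submodule.mem_map_equiv (distributionSpan X s) (e := e) (x := e v)
  rw [e.symm_apply_apply] at h'
  exact h'.symm

/-- A flat chart of the distribution `D`: smooth coordinates with values in the product of the balls
of radius `r`, in which `D` is the kernel of the differential of the second coordinate. The slices
on which this coordinate is constant are the plaques of the foliation. -/
structure IsFlatChart {V W : Type*} [NormedAddCommGroup V] [NormedSpace ℝ V]
    [NormedAddCommGroup W] [NormedSpace ℝ W] (D : (s : M) → Submodule ℝ (TangentSpace (𝓡 d) s))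
    (κ : OpenPartialHomeomorph M (V × W)) (r : ℝ) : Prop extends IsSmoothCoordinates d κ where
  pos : 0 < r
  target_eq : κ.target = Metric.ball 0 r ×ˢ Metric.ball 0 r
  mem_iff : ∀ s ∈ κ.source, ∀ v : TangentSpace (𝓡 d) s,
    v ∈ D s ↔ (mfderiv (𝓡 d) 𝓘(ℝ, V × W) κ s v : V × W).2 = 0

/-- The local Frobenius theorem on a manifold: an involutive distribution of constant rank has flat
charts. -/
theorem exists_isFlatChart [IsManifold (𝓡 d) ∞ M] {W : Type} [NormedAddCommGroup W]
    [NormedSpace ℝ W] [FiniteDimensional ℝ W] (hW : d = K + Module.finrank ℝ W)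
    {X : Fin K → (s : M) → TangentSpace (𝓡 d) s} {Ω : Set M} (hΩ : IsOpen Ω)
    (hX : ∀ k, ContMDiffOn (𝓡 d) (𝓡 d).tangent ∞
      (fun s => (⟨s, X k s⟩ : TangentBundle (𝓡 d) M)) Ω)
    (hinv : ∀ i j, ∀ s ∈ Ω, mlieBracket (𝓡 d) (X i) (X j) s ∈ distributionSpan X s)
    {s₀ : M} (hs₀ : s₀ ∈ Ω) (hli : LinearIndependent ℝ fun k => X k s₀) :
    ∃ (κ : OpenPartialHomeomorph M (EuclideanSpace ℝ (Fin K) × W)) (r : ℝ),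
      IsFlatChart (distributionSpan X) κ r ∧ s₀ ∈ κ.source ∧ κ.source ⊆ Ω := by
  let ψ : OpenPartialHomeomorph M (EuclideanSpace ℝ (Fin d)) := chartAt _ s₀
  have hψ : IsSmoothCoordinates d ψ := ⟨contMDiffOn_chart, contMDiffOn_chart_symm⟩
  have hs₀ψ : s₀ ∈ ψ.source := mem_chart_source _ s₀
  let O : Set (EuclideanSpace ℝ (Fin d)) := ψ.target ∩ ψ.symm ⁻¹' Ω
  have hO : IsOpen O := ψ.isOpen_inter_preimage_symm hΩ
  let Y : Fin K → EuclideanSpace ℝ (Fin d) → EuclideanSpace ℝ (Fin d) :=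
    fun k => inCoordinates ψ (X k)
  have hY : ∀ k, ContDiffOn ℝ ∞ (Y k) O := fun k => hψ.contDiffOn_inCoordinates hΩ (hX k)
  have hinv' : ∀ x ∈ O, ∀ i j,
      lieBracket ℝ (Y i) (Y j) x ∈ Submodule.span ℝ (range fun k => Y k x) := by
    intro x hx i j
    rw [hψ.lieBracket_inCoordinates hΩ (hX i) (hX j) hx.1 hx.2]
    have h := (hψ.mem_distributionSpan_iff X (ψ.map_target hx.1) _).1 (hinv i j _ hx.2)
    rwa [ψ.right_inv hx.1] at h
  have hx₀ : ψ s₀ ∈ O := ⟨ψ.map_source hs₀ψ, by rwa [mem_preimage, ψ.left_inv hs₀ψ]⟩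
  have hli' : LinearIndependent ℝ fun k => Y k (ψ s₀) := by
    let e : TangentSpace (𝓡 d) s₀ ≃ₗ[ℝ] EuclideanSpace ℝ (Fin d) :=
      (hψ.mdifferentiable.mfderiv hs₀ψ).toLinearEquiv
    have h : (fun k => Y k (ψ s₀)) = e ∘ fun k => X k s₀ :=
      funext fun k => inCoordinates_apply (X k) hs₀ψ
    rw [h]
    exact hli.map' e.toLinearMap e.ker
  obtain ⟨L, hL⟩ := exists_linearEquiv_prod (W := W) (injective_frame hli') (by simpa using hW)
  obtain ⟨r, Φ, hr, hsource, hΦ0, htarget, hΦ, hΦsymm, hΦX⟩ :=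
    exists_straightening hO (contDiffOn_frame hY) hx₀ L hL fun x hx =>
      exists_fderiv_frame_sub_eq
        (fun k => ((hY k).contDiffAt (hO.mem_nhds hx)).differentiableAt (by simp)) (hinv' x hx)
  have h0 : (0 : EuclideanSpace ℝ (Fin K) × W) ∈ Φ.source := by
    rw [hsource]
    exact mk_mem_prod (Metric.mem_ball_self hr) (Metric.mem_ball_self hr)
  have hκ : IsSmoothCoordinates d (ψ.trans Φ.symm) := by
    refine ⟨hΦsymm.contMDiffOn.comp (hψ.contMDiffOn.mono ?_) ?_,
      hψ.contMDiffOn_symm.comp (hΦ.contMDiffOn.mono ?_) ?_⟩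
    · exact fun s hs => hs.1
    · exact fun s hs => hs.2
    · exact fun p hp => hp.1
    · exact fun p hp => hp.2
  refine ⟨ψ.trans Φ.symm, r, ⟨hκ, hr, ?_, ?_⟩, ?_, ?_⟩
  · rw [← hsource, OpenPartialHomeomorph.trans_target]
    exact inter_eq_left.2 fun p hp => (htarget (Φ.map_source hp)).1
  · rintro s ⟨hs, hsΦ⟩ v
    have hsΦ' : ψ s ∈ Φ.target := hsΦ
    have hΦm : Φ.MDifferentiable 𝓘(ℝ, EuclideanSpace ℝ (Fin K) × W) (𝓡 d) :=
      ⟨hΦ.contMDiffOn.mdifferentiableOn (by simp), hΦsymm.contMDiffOn.mdifferentiableOn (by simp)⟩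
    have hcomp : mfderiv (𝓡 d) 𝓘(ℝ, EuclideanSpace ℝ (Fin K) × W) (ψ.trans Φ.symm) s v
        = fderiv ℝ Φ.symm (ψ s) (mfderiv (𝓡 d) (𝓡 d) ψ s v) := by
      rw [OpenPartialHomeomorph.coe_trans, mfderiv_comp s (hΦm.mdifferentiableAt_symm hsΦ')
        (hψ.mdifferentiable.mdifferentiableAt hs), mfderiv_eq_fderiv]
      rfl
    obtain ⟨h1, h2⟩ := hΦX _ (Φ.map_target hsΦ')
    rw [Φ.right_inv hsΦ'] at h1 h2
    have h3 : ∀ p, fderiv ℝ Φ.symm (ψ s) (fderiv ℝ Φ (Φ.symm (ψ s)) p) = p := by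
      intro p
      have h := hΦm.symm_comp_deriv (Φ.map_target hsΦ')
      rw [Φ.right_inv hsΦ', mfderiv_eq_fderiv, mfderiv_eq_fderiv] at h
      exact DFunLike.congr_fun h p
    have h4 : ∀ u, fderiv ℝ Φ (Φ.symm (ψ s)) (fderiv ℝ Φ.symm (ψ s) u) = u := by
      intro u
      have h := hΦm.comp_symm_deriv hsΦ'
      rw [mfderiv_eq_fderiv, mfderiv_eq_fderiv] at h
      exact DFunLike.congr_fun h u
    have key : ∀ u : EuclideanSpace ℝ (Fin d),
        u ∈ Submodule.span ℝ (range fun k => Y k (ψ s)) ↔ (fderiv ℝ Φ.symm (ψ s) u).2 = 0 := by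
      intro u
      rw [← exists_frame_eq_iff]
      constructor
      · rintro ⟨w, rfl⟩
        obtain ⟨c, hc⟩ := h1 w
        rw [hc, h3]
      · intro hu
        obtain ⟨w, hw⟩ := h2 (fderiv ℝ Φ.symm (ψ s) u).1
        refine ⟨w, hw.symm.trans ?_⟩
        conv_rhs => rw [← h4 u]
        congr 1
        exact Prod.ext rfl hu.symm
    exact (hψ.mem_distributionSpan_iff X hs v).trans ((key _).trans
      (Iff.of_eq (congrArg (fun z : EuclideanSpace ℝ (Fin K) × W => z.2 = 0) hcomp.symm)))
  · exact ⟨hs₀ψ, by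
      change ψ s₀ ∈ Φ.target
      rw [← hΦ0]
      exact Φ.map_source h0⟩
  · rintro s ⟨hs, hsΦ⟩
    have h : ψ.symm (ψ s) ∈ Ω := (htarget hsΦ).2
    rwa [ψ.left_inv hs] at h

end FlatChart

/-! ### Integral leaves -/

section Leaves

/-- A function with vanishing differential on a connected manifold is constant. -/
lemma eq_of_mfderiv_eq_zero {K : ℕ} {N : Type*} [TopologicalSpace N]
    [ChartedSpace (EuclideanSpace ℝ (Fin K)) N] [IsManifold (𝓡 K) ∞ N] [ConnectedSpace N]
    {W : Type*} [NormedAddCommGroup W] [NormedSpace ℝ W] {g : N → W}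
    (hg : MDifferentiable (𝓡 K) 𝓘(ℝ, W) g) (hg' : ∀ x, mfderiv (𝓡 K) 𝓘(ℝ, W) g x = 0) (x y : N) :
    g x = g y := by
  refine IsLocallyConstant.apply_eq_of_preconnectedSpace ?_ x y
  refine (IsLocallyConstant.iff_eventually_eq g).2 fun x => ?_
  have : IsManifold (𝓡 K) 1 N := IsManifold.of_le (n := ∞) (by simp)
  let φ := chartAt (EuclideanSpace ℝ (Fin K)) x
  have hφ : φ.MDifferentiable (𝓡 K) (𝓡 K) := mdifferentiable_chart x
  have hx : x ∈ φ.source := mem_chart_source _ x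
  have hderiv : ∀ z ∈ φ.target, HasFDerivAt (g ∘ φ.symm)
      (0 : EuclideanSpace ℝ (Fin K) →L[ℝ] W) z := by
    intro z hz
    have h := (hg (φ.symm z)).hasMFDerivAt.comp z (hφ.mdifferentiableAt_symm hz).hasMFDerivAt
    rw [hg'] at h
    exact (hasMFDerivAt_iff_hasFDerivAt.1 h).congr_fderiv (ContinuousLinearMap.zero_comp _)
  obtain ⟨ε, hε, hball⟩ := Metric.mem_nhds_iff.1 (φ.open_target.mem_nhds (φ.map_source hx))
  have hconst : ∀ z ∈ Metric.ball (φ x) ε, g (φ.symm z) = g x := by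
    intro z hz
    have h := (convex_ball (φ x) ε).norm_image_sub_le_of_norm_hasFDerivWithin_le (C := 0)
      (fun w hw => (hderiv w (hball hw)).hasFDerivWithinAt) (by simp)
      (Metric.mem_ball_self hε) hz
    simpa [φ.left_inv hx, sub_eq_zero] using h
  filter_upwards [(φ.continuousAt hx).preimage_mem_nhds (Metric.ball_mem_nhds (φ x) hε),
    φ.open_source.mem_nhds hx] with z hz hzs
  rw [← hconst _ hz, φ.left_inv hzs]

variable {d K : ℕ} {M : Type*} [TopologicalSpace M] [ChartedSpace (EuclideanSpace ℝ (Fin d)) M]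
  {W : Type*} [NormedAddCommGroup W] [NormedSpace ℝ W]
  {D : (s : M) → Submodule ℝ (TangentSpace (𝓡 d) s)}
  {κ : OpenPartialHomeomorph M (EuclideanSpace ℝ (Fin K) × W)} {r : ℝ}

namespace IsFlatChart

/-- A connected integral manifold in the domain of a flat chart lies in a single plaque. -/
lemma snd_eq_of_isConnectedIntegralManifold (hκ : IsFlatChart D κ r) {L : Set M}
    (hL : IsConnectedIntegralManifold K D κ.source L) {p q : M} (hp : p ∈ L) (hq : q ∈ L) :
    (κ p).2 = (κ q).2 := by
  obtain ⟨N, _, _, _, _, _, _, f, hf, -, -, hD, rfl, hU⟩ := hL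
  obtain ⟨x, rfl⟩ := hp
  obtain ⟨y, rfl⟩ := hq
  have hfs : ∀ x, f x ∈ κ.source := fun x => hU (mem_range_self x)
  have hg : ∀ x, HasMFDerivAt (𝓡 K) 𝓘(ℝ, W) (fun x => (κ (f x)).2) x
      ((ContinuousLinearMap.snd ℝ (EuclideanSpace ℝ (Fin K)) W).comp
        ((mfderiv (𝓡 d) 𝓘(ℝ, EuclideanSpace ℝ (Fin K) × W) κ (f x)).comp
          (mfderiv (𝓡 K) (𝓡 d) f x))) := fun x =>
    (ContinuousLinearMap.snd ℝ (EuclideanSpace ℝ (Fin K)) W).hasMFDerivAt.comp x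
      ((hκ.mdifferentiable.mdifferentiableAt (hfs x)).hasMFDerivAt.comp x
        (hf.mdifferentiable (by simp) x).hasMFDerivAt)
  refine eq_of_mfderiv_eq_zero (fun x => (hg x).mdifferentiableAt) (fun x => ?_) x y
  rw [(hg x).mfderiv]
  refine ContinuousLinearMap.ext fun v => ?_
  refine (hκ.mem_iff _ (hfs x) _).1 ?_
  rw [← hD]
  exact ⟨v, rfl⟩

/-- The plaques are connected integral manifolds; they are parametrized by the whole space, which is
diffeomorphic to a ball. -/
lemma isConnectedIntegralManifold_plaque (hκ : IsFlatChart D κ r) {y : W}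
    (hy : y ∈ Metric.ball 0 r) :
    IsConnectedIntegralManifold K D κ.source {s | s ∈ κ.source ∧ (κ s).2 = y} := by
  let β := OpenPartialHomeomorph.univBall (0 : EuclideanSpace ℝ (Fin K)) r
  have hβsource : β.source = univ := OpenPartialHomeomorph.univBall_source _ _
  have hβtarget : β.target = Metric.ball 0 r := OpenPartialHomeomorph.univBall_target _ hκ.pos
  have hβsmooth : ContDiff ℝ ∞ β := OpenPartialHomeomorph.contDiff_univBall
  have hβ : β.MDifferentiable (𝓡 K) (𝓡 K) :=
    ⟨(hβsmooth.contMDiff.mdifferentiable (by simp)).mdifferentiableOn, by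
      rw [hβtarget]
      exact (OpenPartialHomeomorph.contDiffOn_univBall_symm (n := ⊤)).contMDiffOn.mdifferentiableOn
        (by simp)⟩
  have hβc : ∀ c, β c ∈ Metric.ball 0 r := fun c => by
    rw [← hβtarget]
    exact β.map_source (by simp [hβsource])
  have hβ' : ∀ c, Function.Bijective (fderiv ℝ β c) := by
    intro c
    have h := hβ.mfderiv_bijective (x := c) (by simp [hβsource])
    rwa [mfderiv_eq_fderiv] at h
  let j : EuclideanSpace ℝ (Fin K) → EuclideanSpace ℝ (Fin K) × W := fun c => (β c, y)
  have hj : ContDiff ℝ ∞ j := hβsmooth.prodMk contDiff_const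
  have hjt : ∀ c, j c ∈ κ.target := fun c => by
    rw [hκ.target_eq]
    exact mk_mem_prod (hβc c) hy
  have hf : ContMDiff (𝓡 K) (𝓡 d) ∞ (κ.symm ∘ j) := fun c =>
    (hκ.contMDiffOn_symm.contMDiffAt (κ.open_target.mem_nhds (hjt c))).comp c
      hj.contMDiff.contMDiffAt
  have hfs : ∀ c, (κ.symm ∘ j) c ∈ κ.source := fun c => κ.map_target (hjt c)
  have hdf : ∀ c u, (mfderiv (𝓡 d) 𝓘(ℝ, EuclideanSpace ℝ (Fin K) × W) κ ((κ.symm ∘ j) c)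
      (mfderiv (𝓡 K) (𝓡 d) (κ.symm ∘ j) c u) : EuclideanSpace ℝ (Fin K) × W)
        = (fderiv ℝ β c u, 0) := by
    intro c u
    have h1 := (hκ.mdifferentiable.mdifferentiableAt (hfs c)).hasMFDerivAt.comp c
      (hf.mdifferentiable (by simp) c).hasMFDerivAt
    have h2 : κ ∘ κ.symm ∘ j = j := funext fun c => κ.right_inv (hjt c)
    rw [h2] at h1
    have h3 : HasFDerivAt j ((fderiv ℝ β c).prod 0) c :=
      (hβsmooth.differentiable (by simp) c).hasFDerivAt.prodMk (hasFDerivAt_const y c)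
    exact congrArg (fun T : EuclideanSpace ℝ (Fin K) →L[ℝ] EuclideanSpace ℝ (Fin K) × W => T u)
      (hasMFDerivAt_unique h1 h3.hasMFDerivAt)
  refine ⟨EuclideanSpace ℝ (Fin K), inferInstance, inferInstance, inferInstance, inferInstance,
    inferInstance, inferInstance, κ.symm ∘ j, hf, ?_, ?_, ?_, ?_, fun s hs => hs.1⟩
  · intro c c' h
    have h1 := congrArg Prod.fst (κ.symm.injOn (hjt c) (hjt c') h)
    exact β.injOn (by simp [hβsource]) (by simp [hβsource]) h1
  · intro c u u' h
    have h1 := hdf c u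
    rw [h, hdf c u'] at h1
    exact (hβ' c).1 (congrArg Prod.fst h1).symm
  · intro c
    ext v
    rw [hκ.mem_iff _ (hfs c)]
    constructor
    · rintro ⟨u, rfl⟩
      exact congrArg Prod.snd (hdf c u)
    · intro hv
      obtain ⟨u, hu⟩ := (hβ' c).2 (mfderiv (𝓡 d) 𝓘(ℝ, EuclideanSpace ℝ (Fin K) × W) κ
        ((κ.symm ∘ j) c) v : EuclideanSpace ℝ (Fin K) × W).1
      refine ⟨u, hκ.mdifferentiable.mfderiv_injective (hfs c) ?_⟩
      exact (hdf c u).trans (Prod.ext hu hv.symm)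
  · ext s
    constructor
    · rintro ⟨c, rfl⟩
      exact ⟨hfs c, by rw [Function.comp_apply, κ.right_inv (hjt c)]⟩
    · rintro ⟨hs, hsy⟩
      have h := κ.map_source hs
      rw [hκ.target_eq] at h
      have h1 : (κ s).1 ∈ β.target := by
        rw [hβtarget]
        exact h.1
      refine ⟨β.symm (κ s).1, ?_⟩
      have h2 : j (β.symm (κ s).1) = κ s := Prod.ext (β.right_inv h1) hsy.symm
      rw [Function.comp_apply, h2, κ.left_inv hs]

/-- The integral leaves in the domain of a flat chart are the plaques. -/
theorem isIntegralLeaf_iff (hκ : IsFlatChart D κ r) {L : Set M} :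
    IsIntegralLeaf K D κ.source L ↔
      ∃ p ∈ κ.source, L = {s | s ∈ κ.source ∧ (κ s).2 = (κ p).2} := by
  have hplaque : ∀ p ∈ κ.source, IsConnectedIntegralManifold K D κ.source
      {s | s ∈ κ.source ∧ (κ s).2 = (κ p).2} := by
    intro p hp
    have h := κ.map_source hp
    rw [hκ.target_eq] at h
    exact hκ.isConnectedIntegralManifold_plaque h.2
  constructor
  · rintro ⟨hL, hmax⟩
    have hL' := hL
    obtain ⟨N, _, _, _, _, _, hN, f, -, -, -, -, rfl, hU⟩ := hL'
    obtain ⟨x⟩ := hN.toNonempty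
    have hsub : range f ⊆ {s | s ∈ κ.source ∧ (κ s).2 = (κ (f x)).2} := fun s hs =>
      ⟨hU hs, hκ.snd_eq_of_isConnectedIntegralManifold hL hs (mem_range_self x)⟩
    have hx := hU (mem_range_self x)
    exact ⟨f x, hx, hsub.antisymm (hmax (hplaque _ hx) hsub)⟩
  · rintro ⟨p, hp, rfl⟩
    refine ⟨hplaque p hp, fun L' hL' hsub s hs => ?_⟩
    have hU : L' ⊆ κ.source := by
      obtain ⟨_, _, _, _, _, _, _, _, _, _, _, _, _, hU⟩ := hL'
      exact hU
    exact ⟨hU hs, hκ.snd_eq_of_isConnectedIntegralManifold hL' hs (hsub ⟨hp, rfl⟩)⟩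

end IsFlatChart

end Leaves

/-! ### The local orbit space -/

section OrbitSpace

variable {d K : ℕ} {M : Type*} [TopologicalSpace M] [ChartedSpace (EuclideanSpace ℝ (Fin d)) M]
  {W : Type*} [NormedAddCommGroup W] [NormedSpace ℝ W]
  {X : Fin K → (s : M) → TangentSpace (𝓡 d) s}
  {κ : OpenPartialHomeomorph M (EuclideanSpace ℝ (Fin K) × W)} {r : ℝ}

namespace IsFlatChart

lemma snd_inCoordinates_eq_zero (hκ : IsFlatChart (distributionSpan X) κ r) (k : Fin K)
    {x : EuclideanSpace ℝ (Fin K) × W} (hx : x ∈ κ.target) :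
    (inCoordinates κ (X k) x).2 = 0 :=
  (hκ.mem_iff _ (κ.map_target hx) _).1 (Submodule.subset_span (mem_range_self k))

/-- The fields preserve the plaques, because the second coordinate has vanishing derivative along
their integral curves. -/
lemma snd_eq_of_flowStep (hκ : IsFlatChart (distributionSpan X) κ r) {p q : κ.source}
    (h : FlowStep X κ.source p q) : (κ p).2 = (κ q).2 := by
  obtain ⟨k, γ, a, b, ha, hb, hγ, hint⟩ := h
  have hderiv : ∀ t ∈ uIcc a b,
      HasFDerivWithinAt (fun t => (κ (γ t)).2) (0 : ℝ →L[ℝ] W) (uIcc a b) t := by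
    intro t ht
    have h1 : HasMFDerivWithinAt 𝓘(ℝ, ℝ) 𝓘(ℝ, W) (fun t => (κ (γ t)).2) (uIcc a b) t _ :=
      (ContinuousLinearMap.snd ℝ (EuclideanSpace ℝ (Fin K)) W).hasMFDerivAt.comp_hasMFDerivWithinAt
        t ((hκ.mdifferentiable.mdifferentiableAt (hγ t ht)).hasMFDerivAt.comp_hasMFDerivWithinAt t
          (hint t ht))
    refine (hasMFDerivWithinAt_iff_hasFDerivWithinAt.1 h1).congr_fderiv ?_
    refine ContinuousLinearMap.ext fun (u : ℝ) => ?_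
    exact (hκ.mem_iff _ (hγ t ht) _).1
      (Submodule.smul_mem _ u (Submodule.subset_span (mem_range_self k)))
  have h := (convex_uIcc a b).norm_image_sub_le_of_norm_hasFDerivWithin_le (C := 0) hderiv
    (by simp) (right_mem_uIcc (a := a) (b := b)) left_mem_uIcc
  rw [← ha, ← hb]
  simpa [sub_eq_zero] using h

/-- An integral curve, in a plaque, of a field in coordinates gives a flow step on the manifold. -/
lemma flowStep_of_hasDerivAt (hκ : IsFlatChart (distributionSpan X) κ r) {k : Fin K} {y : W}
    {γ : ℝ → EuclideanSpace ℝ (Fin K)} {τ : ℝ}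
    (hγ : ∀ t ∈ uIcc 0 τ, (γ t, y) ∈ κ.target ∧
      HasDerivAt γ (inCoordinates κ (X k) (γ t, y)).1 t)
    (h0 : κ.symm (γ 0, y) ∈ κ.source) (hτ : κ.symm (γ τ, y) ∈ κ.source) :
    FlowStep X κ.source ⟨_, h0⟩ ⟨_, hτ⟩ := by
  refine ⟨k, fun t => κ.symm (γ t, y), 0, τ, rfl, rfl, fun t ht => κ.map_target (hγ t ht).1,
    fun t ht => ?_⟩
  obtain ⟨htgt, hd⟩ := hγ t ht
  have h1 : HasMFDerivAt 𝓘(ℝ, ℝ) 𝓘(ℝ, EuclideanSpace ℝ (Fin K) × W) (fun t => (γ t, y)) t _ :=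
    (hd.hasFDerivAt.prodMk (hasFDerivAt_const y t)).hasMFDerivAt
  have h2 := (hκ.mdifferentiable.mdifferentiableAt_symm htgt).hasMFDerivAt.comp t h1
  refine HasMFDerivAt.hasMFDerivWithinAt (h2.congr_mfderiv ?_)
  refine ContinuousLinearMap.ext fun (u : ℝ) => ?_
  have h3 : (u • (inCoordinates κ (X k) (γ t, y)).1, (0 : W))
      = u • inCoordinates κ (X k) (γ t, y) :=
    Prod.ext rfl (by simp [hκ.snd_inCoordinates_eq_zero k htgt])
  have h4 := DFunLike.congr_fun (hκ.mdifferentiable.symm_comp_deriv (κ.map_target htgt))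
    (u • X k (κ.symm (γ t, y)))
  rw [κ.right_inv htgt] at h4
  refine Eq.trans ?_ h4
  refine congrArg (fun z : EuclideanSpace ℝ (Fin K) × W =>
    mfderiv 𝓘(ℝ, EuclideanSpace ℝ (Fin K) × W) (𝓡 d) κ.symm (γ t, y) z) ?_
  exact h3.trans ((mfderiv (𝓡 d) 𝓘(ℝ, EuclideanSpace ℝ (Fin K) × W) κ
    (κ.symm (γ t, y))).map_smul u (X k (κ.symm (γ t, y)))).symm

/-- The fields span the tangent spaces of the plaques. -/
lemma span_fst_inCoordinates (hκ : IsFlatChart (distributionSpan X) κ r)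
    {x : EuclideanSpace ℝ (Fin K) × W} (hx : x ∈ κ.target) :
    Submodule.span ℝ (range fun k => (inCoordinates κ (X k) x).1) = ⊤ := by
  have hs := κ.map_target hx
  refine eq_top_iff.2 fun v _ => ?_
  obtain ⟨w, hw⟩ := hκ.mdifferentiable.mfderiv_surjective hs (v, 0)
  have h1 := (hκ.mem_distributionSpan_iff X hs w).1
    ((hκ.mem_iff _ hs w).2 (congrArg (fun z : EuclideanSpace ℝ (Fin K) × W => z.2) hw))
  have h2 : (v, (0 : W)) ∈ Submodule.span ℝ (range fun k => inCoordinates κ (X k) x) := by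
    rw [κ.right_inv hx] at h1
    exact Eq.mp (congrArg (fun z : EuclideanSpace ℝ (Fin K) × W =>
      z ∈ Submodule.span ℝ (range fun k => inCoordinates κ (X k) x)) hw) h1
  have h3 := Submodule.mem_map_of_mem (f := LinearMap.fst ℝ (EuclideanSpace ℝ (Fin K)) W) h2
  rwa [Submodule.map_span, ← range_comp] at h3

/-- The local orbits in the domain of a flat chart are the plaques. -/
theorem localOrbitSetoid_iff [IsManifold (𝓡 d) ∞ M] [CompleteSpace W]
    (hκ : IsFlatChart (distributionSpan X) κ r) {Ω : Set M} (hΩ : IsOpen Ω) (hsub : κ.source ⊆ Ω)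
    (hX : ∀ k, ContMDiffOn (𝓡 d) (𝓡 d).tangent ∞
      (fun s => (⟨s, X k s⟩ : TangentBundle (𝓡 d) M)) Ω) {p q : κ.source} :
    (localOrbitSetoid X κ.source).r p q ↔ (κ p).2 = (κ q).2 := by
  constructor
  · intro h
    induction (h : Relation.EqvGen _ _ _) with
    | rel p q h => exact hκ.snd_eq_of_flowStep h
    | refl p => rfl
    | symm p q _ ih => exact ih.symm
    | trans p q s _ _ ih₁ ih₂ => exact ih₁.trans ih₂
  · intro h
    have hp := κ.map_source p.2
    have hq := κ.map_source q.2
    rw [hκ.target_eq] at hp hq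
    have htgt : ∀ c ∈ Metric.ball (0 : EuclideanSpace ℝ (Fin K)) r, (c, (κ p).2) ∈ κ.target := by
      intro c hc
      rw [hκ.target_eq]
      exact mk_mem_prod hc hp.2
    -- the points of the plaque of `p` that lie on the orbit of `p`
    let T : Set (EuclideanSpace ℝ (Fin K)) := {c | ∃ h : κ.symm (c, (κ p).2) ∈ κ.source,
      (localOrbitSetoid X κ.source).r p ⟨_, h⟩}
    have hT : IsFlowInvariant (fun k c => (inCoordinates κ (X k) (c, (κ p).2)).1)
        (Metric.ball 0 r) T := by
      intro k γ τ hγ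
      have h0 := κ.map_target (htgt _ (hγ 0 left_mem_uIcc).1)
      have hτ := κ.map_target (htgt _ (hγ τ right_mem_uIcc).1)
      have hstep := hκ.flowStep_of_hasDerivAt (fun t ht => ⟨htgt _ (hγ t ht).1, (hγ t ht).2⟩) h0 hτ
      exact ⟨fun ⟨_, h'⟩ => ⟨hτ, h'.trans _ _ _ (.rel _ _ hstep)⟩,
        fun ⟨_, h'⟩ => ⟨h0, h'.trans _ _ _ (.symm _ _ (.rel _ _ hstep))⟩⟩
    have hsmooth : ∀ k, ContDiffOn ℝ ∞ (fun c => (inCoordinates κ (X k) (c, (κ p).2)).1)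
        (Metric.ball 0 r) := fun k => contDiff_fst.comp_contDiffOn
      ((hκ.contDiffOn_inCoordinates hΩ (hX k)).comp
        (contDiff_id.prodMk contDiff_const).contDiffOn
          fun c hc => ⟨htgt c hc, hsub (κ.map_target (htgt c hc))⟩)
    have hp' : ((κ p).1, (κ p).2) = κ p := rfl
    have hq' : ((κ q).1, (κ p).2) = κ q := Prod.ext rfl h
    have hpT : (κ p).1 ∈ T := by
      refine ⟨κ.map_target (κ.map_source p.2), ?_⟩
      have h1 : (⟨_, κ.map_target (κ.map_source p.2)⟩ : κ.source) = p :=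
        Subtype.ext (κ.left_inv p.2)
      exact h1.symm ▸ .refl p
    obtain ⟨hqs, hqT⟩ := (hT.mem_iff Metric.isOpen_ball (convex_ball _ _).isPreconnected hsmooth
      (fun c hc => hκ.span_fst_inCoordinates (htgt c hc)) hp.1 hq.1).1 hpT
    have h1 : (⟨_, hqs⟩ : κ.source) = q := Subtype.ext (by
      change κ.symm ((κ q).1, (κ p).2) = q
      rw [hq', κ.left_inv q.2])
    rwa [h1] at hqT

/-- The second coordinate of a flat chart identifies the local orbit space with an open set. -/
theorem exists_isOpenEmbedding_localOrbitSpace [IsManifold (𝓡 d) ∞ M] [CompleteSpace W]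
    (hκ : IsFlatChart (distributionSpan X) κ r) {Ω : Set M} (hΩ : IsOpen Ω) (hsub : κ.source ⊆ Ω)
    (hX : ∀ k, ContMDiffOn (𝓡 d) (𝓡 d).tangent ∞
      (fun s => (⟨s, X k s⟩ : TangentBundle (𝓡 d) M)) Ω) :
    ∃ J : LocalOrbitSpace X κ.source → W,
      Topology.IsOpenEmbedding J ∧ ∀ s : κ.source, J (Quotient.mk _ s) = (κ s).2 := by
  have horbit := fun p q : κ.source => hκ.localOrbitSetoid_iff hΩ hsub hX (p := p) (q := q)
  let g : κ.source → W := fun s => (κ s).2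
  have hg : Continuous g :=
    continuous_snd.comp (continuousOn_iff_continuous_domRestrict.1 κ.continuousOn)
  have hgo : IsOpenMap g := by
    intro O hO
    have h1 : IsOpen (((↑) : κ.source → M) '' O) := κ.open_source.isOpenMap_subtype_val O hO
    have h2 := isOpenMap_snd _ (κ.isOpen_image_of_subset_source h1 (by
      rintro _ ⟨s, -, rfl⟩
      exact s.2))
    rwa [image_image, image_image] at h2
  refine ⟨Quotient.lift g fun p q h => (horbit p q).1 h,
    .of_continuous_injective_isOpenMap (hg.quotient_lift _) ?_ ?_, fun s => rfl⟩
  · intro a b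
    induction a using Quotient.inductionOn
    induction b using Quotient.inductionOn
    exact fun h => Quotient.sound ((horbit _ _).2 h)
  · intro O hO
    have h := hgo _ (hO.preimage continuous_quotient_mk')
    rw [← image_preimage_eq O Quotient.mk_surjective, image_image]
    exact h

/-- A coordinate function transverse to the plaques. -/
lemma contMDiffOn_clm_comp_snd (hκ : IsFlatChart (distributionSpan X) κ r) (ℓ : W →L[ℝ] ℝ) :
    ContMDiffOn (𝓡 d) 𝓘(ℝ, ℝ) ∞ (fun s => ℓ (κ s).2) κ.source :=
  (ℓ.contDiff.comp contDiff_snd).contMDiff.comp_contMDiffOn hκ.contMDiffOn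

lemma scalarDifferential_clm_comp_snd (hκ : IsFlatChart (distributionSpan X) κ r)
    (ℓ : W →L[ℝ] ℝ) {s : M} (hs : s ∈ κ.source) (v : TangentSpace (𝓡 d) s) :
    scalarDifferential (d := d) (fun s => ℓ (κ s).2) s v
      = ℓ (mfderiv (𝓡 d) 𝓘(ℝ, EuclideanSpace ℝ (Fin K) × W) κ s v :
        EuclideanSpace ℝ (Fin K) × W).2 := by
  have h : HasMFDerivAt (𝓡 d) 𝓘(ℝ, ℝ) (fun s => ℓ (κ s).2) s _ :=
    (ℓ.comp (ContinuousLinearMap.snd ℝ (EuclideanSpace ℝ (Fin K)) W)).hasMFDerivAt.comp s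
      (hκ.mdifferentiable.mdifferentiableAt hs).hasMFDerivAt
  rw [scalarDifferential, h.mfderiv]
  rfl

end IsFlatChart

end OrbitSpace

end Frobenius

theorem mainTheorem7 {d K : ℕ} {M : Type*} [TopologicalSpace M]
    [ChartedSpace (EuclideanSpace ℝ (Fin d)) M] [IsManifold (𝓡 d) ∞ M]
    (X : Fin K → (s : M) → TangentSpace (𝓡 d) s) (Ω : Set M) (hΩ : IsOpen Ω)
    (hsmooth : ∀ k, ContMDiffOn (𝓡 d) (𝓡 d).tangent ∞
      (fun s => (⟨s, X k s⟩ : TangentBundle (𝓡 d) M)) Ω)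
    (hrank : ∀ s ∈ Ω, Module.finrank ℝ (distributionSpan X s) = K)
    (hinv : ∀ i j, ∀ s ∈ Ω,
      VectorField.mlieBracket (𝓡 d) (X i) (X j) s ∈ distributionSpan X s)
    (s₀ : M) (hs₀ : s₀ ∈ Ω) :
    ∃ (U : Set M) (I : Fin (d - K) → M → ℝ),
      IsOpen U ∧ s₀ ∈ U ∧ U ⊆ Ω ∧
      -- smooth invariants
      (∀ α, ContMDiffOn (𝓡 d) 𝓘(ℝ, ℝ) ∞ (I α) U) ∧
      (∀ s ∈ U, ∀ k α, scalarDifferential (d := d) (I α) s (X k s) = 0) ∧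
      -- functionally independent
      (∀ s ∈ U, LinearIndependent ℝ (fun α => scalarDifferential (d := d) (I α) s)) ∧
      -- the joint map is constant on the integral leaves in `U`, which are exactly its level sets
      (∀ L, IsIntegralLeaf K (distributionSpan X) U L →
        ∀ p ∈ L, ∀ q ∈ L, (fun α => I α p) = (fun α => I α q)) ∧
      (∀ L, IsIntegralLeaf K (distributionSpan X) U L ↔
        ∃ p ∈ U, L = {q | q ∈ U ∧ (fun α => I α q) = (fun α => I α p)}) ∧
      -- `z = I(s)` is a coordinate system on the local orbit space
      ∃ J : LocalOrbitSpace X U → (Fin (d - K) → ℝ),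
        Topology.IsOpenEmbedding J ∧ ∀ s : U, J (Quotient.mk _ s) = fun α => I α s := by
  have hfd : Module.finrank ℝ (TangentSpace (𝓡 d) s₀) = d := finrank_euclideanSpace_fin
  have : FiniteDimensional ℝ (TangentSpace (𝓡 d) s₀) :=
    inferInstanceAs (FiniteDimensional ℝ (EuclideanSpace ℝ (Fin d)))
  have hKd : K ≤ d := by
    have h := Submodule.finrank_le (distributionSpan X s₀)
    rwa [hrank s₀ hs₀, hfd] at h
  have hli : LinearIndependent ℝ fun k => X k s₀ :=
    linearIndependent_iff_card_eq_finrank_span.2 (by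
      rw [Fintype.card_fin]
      exact (hrank s₀ hs₀).symm)
  obtain ⟨κ, r, hκ, hs₀κ, hκΩ⟩ := Frobenius.exists_isFlatChart (W := Fin (d - K) → ℝ)
    (by rw [Module.finrank_fin_fun]; omega) hΩ hsmooth hinv hs₀ hli
  let ℓ : Fin (d - K) → (Fin (d - K) → ℝ) →L[ℝ] ℝ := fun α => ContinuousLinearMap.proj α
  refine ⟨κ.source, fun α s => ℓ α (κ s).2, κ.open_source, hs₀κ, hκΩ,
    fun α => hκ.contMDiffOn_clm_comp_snd (ℓ α), ?_, ?_, ?_, fun L => hκ.isIntegralLeaf_iff,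
    hκ.exists_isOpenEmbedding_localOrbitSpace hΩ hκΩ hsmooth⟩
  · intro s hs k α
    rw [hκ.scalarDifferential_clm_comp_snd (ℓ α) hs]
    exact congrFun ((hκ.mem_iff s hs _).1 (Submodule.subset_span (Set.mem_range_self k))) α
  · intro s hs
    refine Fintype.linearIndependent_iff.2 fun c hc β => ?_
    -- the tangent vector with coordinates `(0, e_β)` detects the coefficient `c β`
    obtain ⟨v, hv⟩ := hκ.mdifferentiable.mfderiv_surjective hs (0, Pi.single β 1)
    have h1 := DFunLike.congr_fun hc v
    have h2 : ∀ α, scalarDifferential (d := d) (fun s => ℓ α (κ s).2) s v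
        = (Pi.single β (1 : ℝ) : Fin (d - K) → ℝ) α := fun α =>
      (hκ.scalarDifferential_clm_comp_snd (ℓ α) hs v).trans
        (congrArg (fun z : EuclideanSpace ℝ (Fin K) × (Fin (d - K) → ℝ) => z.2 α) hv)
    simpa [sum_apply, h2, Pi.single_apply] using h1
  · intro L hL p hp q hq
    exact hκ.snd_eq_of_isConnectedIntegralManifold hL.1 hp hq
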